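/- Let $k$ be a commutative ring, let $A$, $B$ be associative unital $k$-algebras, let $\mathfrak C$ be an $A$-coring and $\mathfrak D$ a $B$-coring (bimodules are $k$-central), and assume that ${}_A\mathfrak C$ and ${}_B\mathfrak D$ are flat. Write $\mathcal M^{\mathfrak C}$ for the category of right $\mathfrak C$-comodules and ${}^{\mathfrak C}\mathcal M^{\mathfrak D}$ for the category of $\mathfrak C$-$\mathfrak D$-bicomodules. A pair of functors $(F,G)$ is a Frobenius pair if $G$ is both a right and a left adjoint of $F$; then $F$ and $G$ are called Frobenius functors. For $N\in{}^{\mathfrak C}\mathcal M^{\mathfrak D}$ let $-\,\square_{\mathfrak C}N:\mathcal M^{\mathfrak C}\to\mathcal M^{\mathfrak D}$ be the cotensor product functor, $Y\,\square_{\mathfrak C}N=\ker(\rho_Y\otimes_A N-Y\otimes_A\lambda_N)$. The right comodule $N_{\mathfrak D}$ is quasi-finite if $-\otimes_A N:\mathcal M_A\to\mathcal M^{\mathfrak D}$ has a left adjoint $h_{\mathfrak D}(N,-)$; with its canonical right $\mathfrak C$-coaction, this adjoint becomes the co-hom functor $h_{\mathfrak D}(N,-):\mathcal M^{\mathfrak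 D}\to\mathcal M^{\mathfrak C}$, which is the left adjoint of $-\,\square_{\mathfrak C}N$. The right comodule $N_{\mathfrak D}$ is an injector if $-\otimes_A N:\mathcal M_A\to\mathcal M^{\mathfrak D}$ preserves injective objects. If $F:\mathcal M^{\mathfrak C}\to\mathcal M^{\mathfrak D}$ is a $k$-linear functor with a right adjoint, then $F(\mathfrak C)$ is a $\mathfrak C$-$\mathfrak D$-bicomodule: $a\in A$ acts on the left by $F(a\cdot-)$, and the left coaction is $F(\mathfrak C)\xrightarrow{F(\Delta)}F(\mathfrak C\otimes_A\mathfrak C)\cong\mathfrak C\otimes_A F(\mathfrak C)$, where the isomorphism is inverse to $c\otimes x\mapsto F(c\otimes-)(x)$. The same applies to functors $\mathcal M^{\mathfrak D}\to\mathcal M^{\mathfrak C}$. Let $X\in{}^{\mathfrak C}\mathcal M^{\mathfrak D}$ and $\Lambda\in{}^{\mathfrak D}\mathcal M^{\mathfrak C}$. Then the following statements are equivalent: (i) $(-\,\square_{\mathfrak C}X,\;-\,\square_{\mathfrak D}\Lambda)$ is a Frobenius pair; (ii) $-\,\square_{\mathfrak C}X$ is a Frobenius functor, $X_{\mathfrak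 D}$ is quasi-finite, and $h_{\mathfrak D}(X,\mathfrak D)\cong\Lambda$ as bicomodules; (iii) there is a Frobenius pair $(F,G)$ of $k$-linear functors $F:\mathcal M^{\mathfrak C}\to\mathcal M^{\mathfrak D}$, $G:\mathcal M^{\mathfrak D}\to\mathcal M^{\mathfrak C}$ such that $F(\mathfrak C)\cong X$ and $G(\mathfrak D)\cong\Lambda$ as bicomodules; (iv) $\Lambda_{\mathfrak C}$ and $X_{\mathfrak D}$ are quasi-finite injectors, and $X\cong h_{\mathfrak C}(\Lambda,\mathfrak C)$ and $\Lambda\cong h_{\mathfrak D}(X,\mathfrak D)$ as bicomodules; (v) $\Lambda_{\mathfrak C}$ and $X_{\mathfrak D}$ are quasi-finite, and there are natural isomorphisms $-\,\square_{\mathfrak C}X\cong h_{\mathfrak C}(\Lambda,-)$ and $-\,\square_{\mathfrak D}\Lambda\cong h_{\mathfrak D}(X,-)$. -/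

import Mathlib

open MulOpposite CategoryTheory

universe v u

namespace CoringTheory

section Tensor

variable (A : Type*) [Ring A]

/-- The relations `m a ⊗ n = m ⊗ a n` imposed on `M ⊗_ℤ N`. A right `A`-module is a module over
`Aᵐᵒᵖ`, so `m a` is written `op a • m`. -/
def balancing (M N : Type*) [AddCommGroup M] [Module Aᵐᵒᵖ M] [AddCommGroup N] [Module A N] :
    Submodule ℤ (TensorProduct ℤ M N) :=
  Submodule.span ℤ {t | ∃ (m : M) (a : A) (n : N), t =
    TensorProduct.tmul ℤ (op a • m) n - TensorProduct.tmul ℤ m (a • n)}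

/-- The tensor product `M ⊗_A N` of a right and a left module over a (noncommutative) ring. -/
def BT (M N : Type*) [AddCommGroup M] [Module Aᵐᵒᵖ M] [AddCommGroup N] [Module A N] : Type _ :=
  TensorProduct ℤ M N ⧸ balancing A M N

instance (M N : Type*) [AddCommGroup M] [Module Aᵐᵒᵖ M] [AddCommGroup N] [Module A N] :
    AddCommGroup (BT A M N) :=
  inferInstanceAs (AddCommGroup (TensorProduct ℤ M N ⧸ balancing A M N))

namespace BT

section Basic

variable {A}
variable {M M' M'' N N' N'' P : Type*}
  [AddCommGroup M] [Module Aᵐᵒᵖ M] [AddCommGroup M'] [Module Aᵐᵒᵖ M']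
  [AddCommGroup M''] [Module Aᵐᵒᵖ M'']
  [AddCommGroup N] [Module A N] [AddCommGroup N'] [Module A N']
  [AddCommGroup N''] [Module A N''] [AddCommGroup P]

variable (A) in
/-- The pure tensor `m ⊗ n` in `M ⊗_A N`. -/
def tmul (m : M) (n : N) : BT A M N :=
  Submodule.Quotient.mk (p := balancing A M N) (TensorProduct.tmul ℤ m n)

theorem tmul_add (m : M) (n n' : N) : tmul A m (n + n') = tmul A m n + tmul A m n' := by
  unfold tmul
  rw [TensorProduct.tmul_add]
  rfl

theorem add_tmul (m m' : M) (n : N) : tmul A (m + m') n = tmul A m n + tmul A m' n := by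
  unfold tmul
  rw [TensorProduct.add_tmul]
  rfl

theorem smul_tmul (a : A) (m : M) (n : N) : tmul A (op a • m) n = tmul A m (a • n) :=
  (Submodule.Quotient.eq _).2 (Submodule.subset_span ⟨m, a, n, rfl⟩)

theorem induction_on {p : BT A M N → Prop} (t : BT A M N) (h0 : p 0)
    (ht : ∀ m n, p (tmul A m n)) (ha : ∀ s t, p s → p t → p (s + t)) : p t := by
  induction t using Submodule.Quotient.induction_on with
  | _ t =>
    induction t using TensorProduct.induction_on with
    | zero => exact h0
    | tmul m n => exact ht m n
    | add s t hs ht => exact ha _ _ hs ht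

theorem hom_ext {f g : BT A M N →+ P} (h : ∀ m n, f (tmul A m n) = g (tmul A m n)) : f = g := by
  ext t
  induction t using induction_on with
  | h0 => simp
  | ht m n => exact h m n
  | ha s t hs ht => rw [map_add, map_add, hs, ht]

/-- A balanced biadditive map out of `M × N` factors through `M ⊗_A N`. -/
def lift (f : M →+ N →+ P) (h : ∀ (m : M) (a : A) (n : N), f (op a • m) n = f m (a • n)) :
    BT A M N →+ P :=
  ((balancing A M N).liftQ
    (TensorProduct.liftAddHom f (fun r m n => by simp)).toIntLinearMap
    (Submodule.span_le.2 (by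
      rintro _ ⟨m, a, n, rfl⟩
      rw [SetLike.mem_coe, LinearMap.mem_ker, map_sub, sub_eq_zero]
      exact h m a n))).toAddMonoidHom

@[simp] theorem lift_tmul (f : M →+ N →+ P) (h) (m : M) (n : N) :
    lift (A := A) f h (tmul A m n) = f m n := rfl

variable (A M N) in
/-- The pure tensor as a biadditive map. -/
def mk : M →+ N →+ BT A M N :=
  AddMonoidHom.mk' (fun m => AddMonoidHom.mk' (fun n => tmul A m n) (tmul_add m))
    (fun m m' => by ext n; exact add_tmul m m' n)

@[simp] theorem mk_apply (m : M) (n : N) : mk A M N m n = tmul A m n := rfl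

/-- The map `f ⊗_A g : M ⊗_A N → M' ⊗_A N'`. -/
def map (f : M →ₗ[Aᵐᵒᵖ] M') (g : N →ₗ[A] N') : BT A M N →+ BT A M' N' :=
  lift (((mk A M' N').compl₂ g.toAddMonoidHom).comp f.toAddMonoidHom) (by
    intro m a n
    simp [AddMonoidHom.compl₂, smul_tmul])

@[simp] theorem map_tmul (f : M →ₗ[Aᵐᵒᵖ] M') (g : N →ₗ[A] N') (m : M) (n : N) :
    map f g (tmul A m n) = tmul A (f m) (g n) := rfl

theorem map_map (f : M →ₗ[Aᵐᵒᵖ] M') (g : N →ₗ[A] N') (f' : M' →ₗ[Aᵐᵒᵖ] M'')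
    (g' : N' →ₗ[A] N'') (t : BT A M N) :
    map f' g' (map f g t) = map (f' ∘ₗ f) (g' ∘ₗ g) t :=
  DFunLike.congr_fun (hom_ext (f := (map f' g').comp (map f g))
    (g := map (f' ∘ₗ f) (g' ∘ₗ g)) (fun _ _ => rfl)) t

@[simp] theorem map_id (t : BT A M N) : map LinearMap.id LinearMap.id t = t :=
  DFunLike.congr_fun (hom_ext (f := map LinearMap.id LinearMap.id)
    (g := AddMonoidHom.id (BT A M N)) (fun _ _ => rfl)) t

theorem map_add_left (f f' : M →ₗ[Aᵐᵒᵖ] M') (g : N →ₗ[A] N') (t : BT A M N) :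
    map (f + f') g t = map f g t + map f' g t :=
  DFunLike.congr_fun (hom_ext (f := map (f + f') g) (g := map f g + map f' g)
    (fun m n => by simp [add_tmul])) t

/-- `M ⊗_A A → M`, `m ⊗ a ↦ m a`. -/
def rid : BT A M A →+ M :=
  lift (AddMonoidHom.mk' (fun m => AddMonoidHom.mk' (fun a => op a • m)
      (fun a a' => by rw [MulOpposite.op_add, add_smul]))
    (fun m m' => by ext a; exact smul_add _ _ _))
    (fun m a a' => by simp [mul_smul])

@[simp] theorem rid_tmul (m : M) (a : A) : rid (tmul A m a) = op a • m := rfl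

/-- `A ⊗_A N → N`, `a ⊗ n ↦ a n`. -/
def lid : BT A A N →+ N :=
  lift (AddMonoidHom.mk' (fun a => AddMonoidHom.mk' (fun n => a • n) (smul_add a))
    (fun a a' => by ext n; exact add_smul _ _ _))
    (fun a a' n => by simp [mul_smul])

@[simp] theorem lid_tmul (a : A) (n : N) : lid (tmul A a n) = a • n := rfl

end Basic

section Actions

variable {A}
variable {M N : Type*} [AddCommGroup M] [Module Aᵐᵒᵖ M] [AddCommGroup N] [Module A N]
variable {S B : Type*} [Ring S] [Ring B]

/-- Left multiplication by `s` as a right linear map of an `S`-`A`-bimodule. -/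
def lmul [Module S M] [SMulCommClass S Aᵐᵒᵖ M] (s : S) : M →ₗ[Aᵐᵒᵖ] M where
  toFun m := s • m
  map_add' := smul_add s
  map_smul' a m := smul_comm s a m

@[simp] theorem lmul_apply [Module S M] [SMulCommClass S Aᵐᵒᵖ M] (s : S) (m : M) :
    lmul (A := A) s m = s • m := rfl

/-- Right multiplication by `b` as a left linear map of an `A`-`B`-bimodule. -/
def rmul [Module Bᵐᵒᵖ N] [SMulCommClass A Bᵐᵒᵖ N] (b : Bᵐᵒᵖ) : N →ₗ[A] N where
  toFun n := b • n
  map_add' := smul_add b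
  map_smul' a n := (smul_comm a b n).symm

@[simp] theorem rmul_apply [Module Bᵐᵒᵖ N] [SMulCommClass A Bᵐᵒᵖ N] (b : Bᵐᵒᵖ) (n : N) :
    rmul (A := A) b n = b • n := rfl

/-- `M ⊗_A N` is a left `S`-module when `M` is an `S`-`A`-bimodule. -/
instance leftModule [Module S M] [SMulCommClass S Aᵐᵒᵖ M] : Module S (BT A M N) where
  smul s t := map (lmul s) LinearMap.id t
  one_smul t := by
    change map _ _ t = t
    induction t using induction_on with
    | h0 => simp
    | ht m n => simp
    | ha s t hs ht => rw [map_add, hs, ht]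
  mul_smul r s t := by
    change map _ _ t = map _ _ (map _ _ t)
    induction t using induction_on with
    | h0 => simp
    | ht m n => simp [mul_smul]
    | ha s t hs ht => simp only [map_add, hs, ht]
  smul_zero s := map_zero _
  smul_add s := map_add _
  add_smul r s t := by
    change map _ _ t = map _ _ t + map _ _ t
    induction t using induction_on with
    | h0 => simp
    | ht m n => simp [add_smul, add_tmul]
    | ha s t hs ht => simp only [map_add, hs, ht]; abel
  zero_smul t := by
    change map _ _ t = 0
    induction t using induction_on with
    | h0 => simp
    | ht m n =>
      simp only [map_tmul, lmul_apply, zero_smul, LinearMap.id_coe, id_eq]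
      exact map_zero ((mk A M N).flip n)
    | ha s t hs ht => rw [map_add, hs, ht, add_zero]

@[simp] theorem smul_tmul_left [Module S M] [SMulCommClass S Aᵐᵒᵖ M] (s : S) (m : M) (n : N) :
    s • tmul A m n = tmul A (s • m) n := rfl

/-- `M ⊗_A N` is a right `B`-module when `N` is an `A`-`B`-bimodule. -/
instance rightModule [Module Bᵐᵒᵖ N] [SMulCommClass A Bᵐᵒᵖ N] : Module Bᵐᵒᵖ (BT A M N) where
  smul b t := map LinearMap.id (rmul b) t
  one_smul t := by
    change map _ _ t = t
    induction t using induction_on with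
    | h0 => simp
    | ht m n => simp
    | ha s t hs ht => rw [map_add, hs, ht]
  mul_smul r s t := by
    change map _ _ t = map _ _ (map _ _ t)
    induction t using induction_on with
    | h0 => simp
    | ht m n => simp [mul_smul]
    | ha s t hs ht => simp only [map_add, hs, ht]
  smul_zero s := map_zero _
  smul_add s := map_add _
  add_smul r s t := by
    change map _ _ t = map _ _ t + map _ _ t
    induction t using induction_on with
    | h0 => simp
    | ht m n => simp [add_smul, tmul_add]
    | ha s t hs ht => simp only [map_add, hs, ht]; abel
  zero_smul t := by
    change map _ _ t = 0
    induction t using induction_on with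
    | h0 => simp
    | ht m n =>
      simp only [map_tmul, rmul_apply, zero_smul, LinearMap.id_coe, id_eq]
      exact map_zero (mk A M N m)
    | ha s t hs ht => rw [map_add, hs, ht, add_zero]

@[simp] theorem smul_tmul_right [Module Bᵐᵒᵖ N] [SMulCommClass A Bᵐᵒᵖ N] (b : Bᵐᵒᵖ) (m : M)
    (n : N) : b • tmul A m n = tmul A m (b • n) := rfl

instance bimodule [Module S M] [SMulCommClass S Aᵐᵒᵖ M] [Module Bᵐᵒᵖ N]
    [SMulCommClass A Bᵐᵒᵖ N] : SMulCommClass S Bᵐᵒᵖ (BT A M N) where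
  smul_comm s b t := by
    induction t using induction_on with
    | h0 => simp
    | ht m n => simp
    | ha x y hx hy => simp only [smul_add, hx, hy]

variable {M' N' : Type*} [AddCommGroup M'] [Module Aᵐᵒᵖ M'] [AddCommGroup N'] [Module A N']

theorem map_smul_left [Module S M] [SMulCommClass S Aᵐᵒᵖ M] [Module S M']
    [SMulCommClass S Aᵐᵒᵖ M'] (f : M →ₗ[Aᵐᵒᵖ] M') (g : N →ₗ[A] N')
    (hf : ∀ (s : S) m, f (s • m) = s • f m) (s : S) (t : BT A M N) :
    map f g (s • t) = s • map f g t := by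
  induction t using induction_on with
  | h0 => simp
  | ht m n => simp [hf]
  | ha x y hx hy => simp only [smul_add, map_add, hx, hy]

theorem map_smul_right [Module Bᵐᵒᵖ N] [SMulCommClass A Bᵐᵒᵖ N] [Module Bᵐᵒᵖ N']
    [SMulCommClass A Bᵐᵒᵖ N'] (f : M →ₗ[Aᵐᵒᵖ] M') (g : N →ₗ[A] N')
    (hg : ∀ (b : Bᵐᵒᵖ) n, g (b • n) = b • g n) (b : Bᵐᵒᵖ) (t : BT A M N) :
    map f g (b • t) = b • map f g t := by
  induction t using induction_on with
  | h0 => simp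
  | ht m n => simp [hg]
  | ha x y hx hy => simp only [smul_add, map_add, hx, hy]

/-- `m ⊗ - : N → M ⊗_A N` as a right `B`-linear map, for an `A`-`B`-bimodule `N`. -/
def tmulRight [Module Bᵐᵒᵖ N] [SMulCommClass A Bᵐᵒᵖ N] (m : M) : N →ₗ[Bᵐᵒᵖ] BT A M N where
  toFun n := tmul A m n
  map_add' := tmul_add m
  map_smul' _ _ := rfl

@[simp] theorem tmulRight_apply [Module Bᵐᵒᵖ N] [SMulCommClass A Bᵐᵒᵖ N] (m : M) (n : N) :
    tmulRight (A := A) (B := B) m n = tmul A m n := rfl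

/-- `- ⊗ p : N → N ⊗_B P` as a left `A`-linear map, for an `A`-`B`-bimodule `N`. -/
def tmulLeft [Module Bᵐᵒᵖ N] [SMulCommClass A Bᵐᵒᵖ N] {P : Type*} [AddCommGroup P] [Module B P]
    (p : P) : N →ₗ[A] BT B N P where
  toFun n := tmul B n p
  map_add' n n' := add_tmul n n' p
  map_smul' _ _ := rfl

@[simp] theorem tmulLeft_apply [Module Bᵐᵒᵖ N] [SMulCommClass A Bᵐᵒᵖ N] {P : Type*}
    [AddCommGroup P] [Module B P] (p : P) (n : N) :
    tmulLeft (A := A) (B := B) p n = tmul B n p := rfl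

/-- `f ⊗_A N` as a right `B`-linear map, for an `A`-`B`-bimodule `N`. -/
def rTensor (N : Type*) [AddCommGroup N] [Module A N] [Module Bᵐᵒᵖ N] [SMulCommClass A Bᵐᵒᵖ N]
    (f : M →ₗ[Aᵐᵒᵖ] M') : BT A M N →ₗ[Bᵐᵒᵖ] BT A M' N where
  toFun := map f LinearMap.id
  map_add' := map_add _
  map_smul' := map_smul_right f LinearMap.id (fun _ _ => rfl)

@[simp] theorem rTensor_apply [Module Bᵐᵒᵖ N] [SMulCommClass A Bᵐᵒᵖ N]
    (f : M →ₗ[Aᵐᵒᵖ] M') (t : BT A M N) :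
    rTensor (B := B) N f t = map f LinearMap.id t := rfl

end Actions

section Associator

variable {A}
variable {B : Type*} [Ring B]
variable {M N P : Type*} [AddCommGroup M] [Module Aᵐᵒᵖ M]
  [AddCommGroup N] [Module A N] [Module Bᵐᵒᵖ N] [SMulCommClass A Bᵐᵒᵖ N]
  [AddCommGroup P] [Module B P]

variable (M N P) in
/-- `(M ⊗_A N) ⊗_B P → M ⊗_A (N ⊗_B P)`. -/
def assocHom : BT B (BT A M N) P →+ BT A M (BT B N P) :=
  lift (AddMonoidHom.flip (AddMonoidHom.mk'
    (fun p => map (A := A) (LinearMap.id (M := M)) (tmulLeft (N := N) (B := B) p))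
    (fun p p' => hom_ext (fun m n => by simp [tmul_add]))))
    (by
      intro t b p
      induction t using induction_on with
      | h0 => simp
      | ht m n => simp [smul_tmul]
      | ha x y hx hy => simp only [smul_add, map_add, AddMonoidHom.add_apply, hx, hy])

variable (M N P) in
/-- `M ⊗_A (N ⊗_B P) → (M ⊗_A N) ⊗_B P`. -/
def assocInv : BT A M (BT B N P) →+ BT B (BT A M N) P :=
  lift (AddMonoidHom.mk'
    (fun m => map (A := B) (tmulRight (A := A) (N := N) m) (LinearMap.id (M := P)))
    (fun m m' => hom_ext (fun n p => by simp [add_tmul])))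
    (by
      intro m a t
      induction t using induction_on with
      | h0 => simp
      | ht n p => simp [smul_tmul]
      | ha x y hx hy => simp only [smul_add, map_add, hx, hy])

variable (M N P) in
/-- The associativity isomorphism `(M ⊗_A N) ⊗_B P ≅ M ⊗_A (N ⊗_B P)`. -/
def assoc : BT B (BT A M N) P ≃+ BT A M (BT B N P) where
  toFun := assocHom M N P
  invFun := assocInv M N P
  left_inv t := by
    induction t using induction_on with
    | h0 => simp
    | ht s p =>
      induction s using induction_on with
      | h0 =>
        have : tmul B (0 : BT A M N) p = 0 := map_zero ((mk B (BT A M N) P).flip p)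
        simp [this]
      | ht m n => rfl
      | ha x y hx hy => simp only [add_tmul, map_add, hx, hy]
    | ha x y hx hy => simp only [map_add, hx, hy]
  right_inv t := by
    induction t using induction_on with
    | h0 => simp
    | ht m s =>
      induction s using induction_on with
      | h0 =>
        have : tmul A m (0 : BT B N P) = 0 := map_zero (mk A M (BT B N P) m)
        simp [this]
      | ht m n => rfl
      | ha x y hx hy => simp only [tmul_add, map_add, hx, hy]
    | ha x y hx hy => simp only [map_add, hx, hy]
  map_add' := map_add _

@[simp] theorem assoc_tmul (m : M) (n : N) (p : P) :
    assoc M N P (tmul B (tmul A m n) p) = tmul A m (tmul B n p) := rfl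

@[simp] theorem assoc_symm_tmul (m : M) (n : N) (p : P) :
    (assoc M N P).symm (tmul A m (tmul B n p)) = tmul B (tmul A m n) p := rfl

theorem assoc_symm_tmul_right (m : M) (t : BT B N P) :
    (assoc M N P).symm (tmul A m t) = map (tmulRight (A := A) m) LinearMap.id t := rfl

theorem assoc_symm_smul {E : Type*} [Ring E] [Module Eᵐᵒᵖ P] [SMulCommClass B Eᵐᵒᵖ P]
    (e : Eᵐᵒᵖ) (t : BT A M (BT B N P)) :
    (assoc M N P).symm (e • t) = e • (assoc M N P).symm t := by
  induction t using induction_on with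
  | h0 => simp
  | ht m s =>
    rw [smul_tmul_right, assoc_symm_tmul_right, assoc_symm_tmul_right]
    exact map_smul_right _ LinearMap.id (fun _ _ => rfl) e s
  | ha x y hx hy => simp only [smul_add, map_add, hx, hy]

theorem assoc_rTensor {M' : Type*} [AddCommGroup M'] [Module Aᵐᵒᵖ M'] (f : M →ₗ[Aᵐᵒᵖ] M')
    (t : BT B (BT A M N) P) :
    assoc M' N P (map (rTensor N f) LinearMap.id t) = map f LinearMap.id (assoc M N P t) := by
  induction t using induction_on with
  | h0 => simp
  | ht s p =>
    induction s using induction_on with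
    | h0 =>
      have : tmul B (0 : BT A M N) p = 0 := map_zero ((mk B (BT A M N) P).flip p)
      simp [this]
    | ht m n => rfl
    | ha x y hx hy => simp only [add_tmul, map_add, hx, hy]
  | ha x y hx hy => simp only [map_add, hx, hy]

end Associator

theorem rid_map {A : Type*} [Ring A] {M M' : Type*} [AddCommGroup M] [Module Aᵐᵒᵖ M]
    [AddCommGroup M'] [Module Aᵐᵒᵖ M'] (f : M →ₗ[Aᵐᵒᵖ] M') (t : BT A M A) :
    rid (map f LinearMap.id t) = f (rid t) := by
  induction t using induction_on with
  | h0 => simp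
  | ht m a => simp
  | ha x y hx hy => simp only [map_add, hx, hy]

theorem map_comm {A : Type*} [Ring A] {M M' N N' : Type*} [AddCommGroup M] [Module Aᵐᵒᵖ M]
    [AddCommGroup M'] [Module Aᵐᵒᵖ M'] [AddCommGroup N] [Module A N] [AddCommGroup N']
    [Module A N'] (f : M →ₗ[Aᵐᵒᵖ] M') (g : N →ₗ[A] N') (t : BT A M N) :
    map LinearMap.id g (map f LinearMap.id t) = map f LinearMap.id (map LinearMap.id g t) := by
  rw [map_map, map_map]
  rfl

end BT

end Tensor

/-- A left `B`-module `D` is flat: `- ⊗_B D` preserves exactness of sequences of right modules. -/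
class LeftFlat (B : Type u) [Ring B] (D : Type u) [AddCommGroup D] [Module B D] : Prop where
  exact : ∀ (L M N : Type u) [AddCommGroup L] [Module Bᵐᵒᵖ L] [AddCommGroup M] [Module Bᵐᵒᵖ M]
    [AddCommGroup N] [Module Bᵐᵒᵖ N] (f : L →ₗ[Bᵐᵒᵖ] M) (g : M →ₗ[Bᵐᵒᵖ] N),
    Function.Exact f g →
      Function.Exact (BT.map f (LinearMap.id : D →ₗ[B] D)) (BT.map g (LinearMap.id : D →ₗ[B] D))

/-- The two actions of the ground ring `k` on an `A`-`B`-bimodule coincide, as is always required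
of bimodules over `k`-algebras. -/
class CentralBimodule (k : Type v) [CommRing k] (A B : Type u) [Ring A] [Algebra k A] [Ring B]
    [Algebra k B] (M : Type u) [AddCommGroup M] [Module A M] [Module Bᵐᵒᵖ M] : Prop where
  central : ∀ (r : k) (m : M), algebraMap k A r • m = op (algebraMap k B r) • m

/-- A map that is linear over `R` and commutes with `S`, seen as an `S`-linear map. -/
def relin {R S M N : Type*} [Ring R] [Ring S] [AddCommGroup M] [AddCommGroup N] [Module R M]
    [Module R N] [Module S M] [Module S N] (f : M →ₗ[R] N)
    (h : ∀ (s : S) (m : M), f (s • m) = s • f m) : M →ₗ[S] N where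
  toFun := f
  map_add' := map_add f
  map_smul' := h

@[simp] theorem relin_apply {R S M N : Type*} [Ring R] [Ring S] [AddCommGroup M]
    [AddCommGroup N] [Module R M] [Module R N] [Module S M] [Module S N] (f : M →ₗ[R] N)
    (h : ∀ (s : S) (m : M), f (s • m) = s • f m) (m : M) : relin f h m = f m := rfl

/-- An `A`-coring: an `A`-bimodule `C` with a coassociative and counital comultiplication
`Δ : C → C ⊗_A C` and counit `ε : C → A`, both bimodule maps. -/
class Coring (A : Type u) [Ring A] (C : Type u) [AddCommGroup C] [Module A C] [Module Aᵐᵒᵖ C]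
    [SMulCommClass A Aᵐᵒᵖ C] where
  Δ : C →ₗ[A] BT A C C
  Δ_op : ∀ (a : Aᵐᵒᵖ) (c : C), Δ (a • c) = a • Δ c
  ε : C →ₗ[A] A
  ε_op : ∀ (a : Aᵐᵒᵖ) (c : C), ε (a • c) = a • ε c
  coassoc : ∀ c : C,
    BT.assoc C C C (BT.map (relin Δ Δ_op) LinearMap.id (Δ c)) = BT.map LinearMap.id Δ (Δ c)
  counit_left : ∀ c : C, BT.lid (BT.map (relin ε ε_op) LinearMap.id (Δ c)) = c
  counit_right : ∀ c : C, BT.rid (BT.map LinearMap.id ε (Δ c)) = c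


section Comodules

variable (A : Type u) [Ring A] (C : Type u) [AddCommGroup C] [Module A C] [Module Aᵐᵒᵖ C]
  [SMulCommClass A Aᵐᵒᵖ C] [Coring A C]

/-- A right comodule over the `A`-coring `C`. -/
structure RComod where
  carrier : Type u
  [acg : AddCommGroup carrier]
  [mod : Module Aᵐᵒᵖ carrier]
  ρ : carrier →ₗ[Aᵐᵒᵖ] BT A carrier C
  coassoc : ∀ m, BT.assoc carrier C C (BT.map ρ LinearMap.id (ρ m)) =
    BT.map LinearMap.id (Coring.Δ (A := A) (C := C)) (ρ m)
  counit : ∀ m, BT.rid (BT.map LinearMap.id (Coring.ε (A := A) (C := C)) (ρ m)) = m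

attribute [instance] RComod.acg RComod.mod

namespace RComod

variable {A C}

/-- A morphism of right comodules: a right linear map compatible with the coactions. -/
@[ext] structure Hom (M N : RComod A C) where
  lin : M.carrier →ₗ[Aᵐᵒᵖ] N.carrier
  comm : ∀ m, BT.map lin LinearMap.id (M.ρ m) = N.ρ (lin m)

/-- The category `M^C` of right `C`-comodules. -/
instance : Category (RComod A C) where
  Hom M N := Hom M N
  id M := ⟨LinearMap.id, fun m => BT.map_id _⟩
  comp f g := ⟨g.lin ∘ₗ f.lin, fun m => by
    have h : BT.map (g.lin ∘ₗ f.lin) (LinearMap.id : C →ₗ[A] C) =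
      (BT.map g.lin LinearMap.id).comp (BT.map f.lin LinearMap.id) := BT.hom_ext fun _ _ => rfl
    rw [h, AddMonoidHom.comp_apply, f.comm, g.comm]
    rfl⟩

@[simp] theorem id_lin (M : RComod A C) : Hom.lin (𝟙 M) = LinearMap.id := rfl

@[simp] theorem comp_lin {M N P : RComod A C} (f : M ⟶ N) (g : N ⟶ P) :
    Hom.lin (f ≫ g) = Hom.lin g ∘ₗ Hom.lin f := rfl

@[ext] theorem hom_ext {M N : RComod A C} {f g : M ⟶ N} (h : ∀ m, f.lin m = g.lin m) : f = g :=
  Hom.ext (LinearMap.ext h)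

section Additive

variable {M N : RComod A C}

instance : Add (M ⟶ N) where
  add f g := ⟨f.lin + g.lin, fun m => by
    rw [BT.map_add_left, f.comm, g.comm, LinearMap.add_apply, map_add]⟩

theorem map_zero_left (t : BT A M.carrier C) :
    BT.map (0 : M.carrier →ₗ[Aᵐᵒᵖ] N.carrier) (LinearMap.id : C →ₗ[A] C) t = 0 := by
  have := BT.map_add_left (0 : M.carrier →ₗ[Aᵐᵒᵖ] N.carrier) 0 (LinearMap.id : C →ₗ[A] C) t
  rwa [add_zero, left_eq_add] at this

instance : Zero (M ⟶ N) where
  zero := ⟨0, fun m => by rw [map_zero_left]; simp⟩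

instance : Neg (M ⟶ N) where
  neg f := ⟨-f.lin, fun m => by
    rw [LinearMap.neg_apply, map_neg, ← f.comm, eq_neg_iff_add_eq_zero, ← BT.map_add_left,
      neg_add_cancel, map_zero_left]⟩

instance : AddCommGroup (M ⟶ N) where
  add_assoc f g h := by ext m; exact add_assoc _ _ _
  zero_add f := by ext m; exact zero_add _
  add_zero f := by ext m; exact add_zero _
  add_comm f g := by ext m; exact add_comm _ _
  neg_add_cancel f := by ext m; exact neg_add_cancel _
  nsmul := nsmulRec
  zsmul := zsmulRec

@[simp] theorem add_lin (f g : M ⟶ N) : Hom.lin (f + g) = f.lin + g.lin := rfl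

@[simp] theorem neg_lin (f : M ⟶ N) : Hom.lin (-f) = -f.lin := rfl

@[simp] theorem sub_lin (f g : M ⟶ N) : Hom.lin (f - g) = f.lin - g.lin := by
  rw [sub_eq_add_neg, sub_eq_add_neg]
  rfl

end Additive

instance : Preadditive (RComod A C) where
  add_comp M N P f f' g := by ext m; exact map_add g.lin _ _
  comp_add M N P f g g' := by ext m; rfl

section Linear

variable (k : Type v) [CommRing k] [Algebra k A]

/-- A scalar of `k` acting on a right `A`-module through `k → A`. -/
def scalar {M : Type u} [AddCommGroup M] [Module Aᵐᵒᵖ M] (r : k) : M →ₗ[Aᵐᵒᵖ] M where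
  toFun m := op (algebraMap k A r) • m
  map_add' := smul_add _
  map_smul' a m := by
    rw [RingHom.id_apply, smul_smul, smul_smul]
    congr 1
    induction a using MulOpposite.rec' with
    | h a => rw [← op_mul, ← op_mul, Algebra.commutes]

variable {M N : RComod A C}

variable [CentralBimodule k A A C]

instance : SMul k (M ⟶ N) where
  smul r f := ⟨scalar k r ∘ₗ f.lin, fun m => by
    have h : ∀ t : BT A N.carrier C, BT.map (scalar k r) LinearMap.id t =
        op (algebraMap k A r) • t := by
      intro t
      induction t using BT.induction_on with
      | h0 => simp
      | ht n c =>
        rw [BT.smul_tmul_right, ← CentralBimodule.central (A := A) (B := A)]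
        exact BT.smul_tmul _ _ _
      | ha s t hs ht => rw [map_add, hs, ht, smul_add]
    have h' := BT.map_map f.lin (LinearMap.id : C →ₗ[A] C) (scalar k r) LinearMap.id (M.ρ m)
    rw [LinearMap.id_comp] at h'
    rw [← h', f.comm, h, ← map_smul]
    rfl⟩

@[simp] theorem smul_lin (r : k) (f : M ⟶ N) (m : M.carrier) :
    (r • f).lin m = op (algebraMap k A r) • f.lin m := rfl

instance : Module k (M ⟶ N) where
  one_smul f := by ext m; simp
  mul_smul r s f := by
    ext m
    simp only [smul_lin, map_mul, smul_smul]
    rw [← op_mul, ← map_mul, mul_comm, map_mul]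
  smul_zero r := by ext m; exact smul_zero _
  smul_add r f g := by ext m; exact smul_add _ _ _
  add_smul r s f := by
    ext m
    simp only [smul_lin, map_add, MulOpposite.op_add, add_smul]
    rfl
  zero_smul f := by
    ext m
    simp only [smul_lin, map_zero, op_zero, zero_smul]
    rfl

/-- `M^C` is a `k`-linear category. -/
instance : Linear k (RComod A C) where
  homModule _ _ := inferInstance
  smul_comp M N P r f g := by ext m; exact map_smul g.lin _ _
  comp_smul M N P f r g := by ext m; rfl

end Linear

end RComod

end Comodules

section Bicomodules

variable (k : Type v) [CommRing k]
  (A : Type u) [Ring A] [Algebra k A]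
  (C : Type u) [AddCommGroup C] [Module A C] [Module Aᵐᵒᵖ C] [SMulCommClass A Aᵐᵒᵖ C] [Coring A C]
  (B : Type u) [Ring B] [Algebra k B]
  (D : Type u) [AddCommGroup D] [Module B D] [Module Bᵐᵒᵖ D] [SMulCommClass B Bᵐᵒᵖ D] [Coring B D]

/-- An `A`-`D`-bicomodule for a `k`-algebra `A` and a `B`-coring `D`: an `A`-`B`-bimodule with a
left `A`-linear right `D`-coaction `rho`. -/
structure ModComod where
  carrier : Type u
  [acg : AddCommGroup carrier]
  [left : Module A carrier]
  [right : Module Bᵐᵒᵖ carrier]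
  [smulComm : SMulCommClass A Bᵐᵒᵖ carrier]
  [central : CentralBimodule k A B carrier]
  rho : carrier →ₗ[Bᵐᵒᵖ] BT B carrier D
  rho_smul : ∀ (a : A) (x : carrier), rho (a • x) = a • rho x
  rho_coassoc : ∀ x, BT.assoc carrier D D (BT.map rho LinearMap.id (rho x)) =
    BT.map LinearMap.id (Coring.Δ (A := B) (C := D)) (rho x)
  rho_counit : ∀ x, BT.rid (BT.map LinearMap.id (Coring.ε (A := B) (C := D)) (rho x)) = x

attribute [instance] ModComod.acg ModComod.left ModComod.right ModComod.smulComm ModComod.central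

/-- A `C`-`D`-bicomodule over an `A`-coring `C` and a `B`-coring `D`: an `A`-`B`-bimodule with a
left `C`-coaction `lam` and a right `D`-coaction `rho`, both bimodule maps, that commute. -/
structure Bicomod extends ModComod k A B D where
  lam : carrier →ₗ[A] BT A C carrier
  lam_op : ∀ (b : Bᵐᵒᵖ) (x : carrier), lam (b • x) = b • lam x
  lam_coassoc : ∀ x, BT.assoc C C carrier
    (BT.map (relin (Coring.Δ (A := A) (C := C)) Coring.Δ_op) LinearMap.id (lam x)) =
      BT.map LinearMap.id lam (lam x)
  lam_counit : ∀ x,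
    BT.lid (BT.map (relin (Coring.ε (A := A) (C := C)) Coring.ε_op) LinearMap.id (lam x)) = x
  lam_rho : ∀ x, BT.assoc C carrier D (BT.map (relin lam lam_op) LinearMap.id (rho x)) =
    BT.map LinearMap.id (relin rho rho_smul) (lam x)

variable {k A C B D}

namespace Bicomod

/-- A morphism of bicomodules: a bimodule map compatible with both coactions. -/
@[ext] structure Hom (X Y : Bicomod k A C B D) where
  lin : X.carrier →ₗ[A] Y.carrier
  lin_op : ∀ (b : Bᵐᵒᵖ) (x : X.carrier), lin (b • x) = b • lin x
  comm_lam : ∀ x, BT.map LinearMap.id lin (X.lam x) = Y.lam (lin x)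
  comm_rho : ∀ x, BT.map (relin lin lin_op) LinearMap.id (X.rho x) = Y.rho (lin x)

/-- The category `^C M^D` of bicomodules. -/
instance : Category (Bicomod k A C B D) where
  Hom X Y := Hom X Y
  id X := ⟨LinearMap.id, fun _ _ => rfl, fun x => BT.map_id _, fun x => BT.map_id _⟩
  comp f g := ⟨g.lin ∘ₗ f.lin, fun b x => by
      rw [LinearMap.comp_apply, LinearMap.comp_apply, f.lin_op, g.lin_op],
    fun x => by
      have h := BT.map_map (LinearMap.id : C →ₗ[Aᵐᵒᵖ] C) f.lin LinearMap.id g.lin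
      rw [LinearMap.id_comp] at h
      rw [← h, f.comm_lam, g.comm_lam]
      rfl,
    fun x => by
      have h := BT.map_map (relin f.lin f.lin_op) (LinearMap.id : D →ₗ[B] D)
        (relin g.lin g.lin_op) LinearMap.id
      rw [LinearMap.id_comp] at h
      refine (h _).symm.trans ?_
      rw [f.comm_rho, g.comm_rho]
      rfl⟩

/-- The right `D`-linear left coaction `X → C ⊗_A X`. -/
def lamR (X : Bicomod k A C B D) : X.carrier →ₗ[Bᵐᵒᵖ] BT A C X.carrier := relin X.lam X.lam_op

variable (k A C) in
/-- The coring `C` as a bicomodule over itself. -/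
abbrev regular [CentralBimodule k A A C] : Bicomod k A C A C where
  carrier := C
  lam := Coring.Δ
  lam_op := Coring.Δ_op
  rho := relin Coring.Δ Coring.Δ_op
  rho_smul a x := map_smul Coring.Δ a x
  lam_coassoc := Coring.coassoc
  lam_counit := Coring.counit_left
  rho_coassoc := Coring.coassoc
  rho_counit := Coring.counit_right
  lam_rho := Coring.coassoc

end Bicomod

namespace ModComod

/-- The underlying right comodule. -/
abbrev toRComod (X : ModComod k A B D) : RComod B D where
  carrier := X.carrier
  ρ := X.rho
  coassoc := X.rho_coassoc
  counit := X.rho_counit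

/-- The left `A`-linear right coaction `X → X ⊗_B D`. -/
def rhoL (X : ModComod k A B D) : X.carrier →ₗ[A] BT B X.carrier D := relin X.rho X.rho_smul

end ModComod

section TensorComod

variable (Z : Type u) [AddCommGroup Z] [Module Aᵐᵒᵖ Z] (X : ModComod k A B D)

/-- The right coaction `Z ⊗_A X → Z ⊗_A (X ⊗_B D) ≅ (Z ⊗_A X) ⊗_B D`. -/
def tensorρ : BT A Z X.carrier →ₗ[Bᵐᵒᵖ] BT B (BT A Z X.carrier) D where
  toFun t := (BT.assoc Z X.carrier D).symm (BT.map LinearMap.id X.rhoL t)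
  map_add' s t := by rw [map_add, map_add]
  map_smul' b t := by
    rw [RingHom.id_apply, BT.map_smul_right _ X.rhoL (fun b x => map_smul X.rho b x),
      BT.assoc_symm_smul]

theorem tensorρ_tmul (z : Z) (x : X.carrier) :
    tensorρ Z X (BT.tmul A z x) = BT.map (BT.tmulRight z) LinearMap.id (X.rho x) := rfl

/-- The right `D`-comodule `Z ⊗_A X` for a right `A`-module `Z`. -/
abbrev tensorComod : RComod B D where
  carrier := BT A Z X.carrier
  ρ := tensorρ Z X
  coassoc t := by
    induction t using BT.induction_on with
    | h0 => simp
    | ht z x =>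
      have e : tensorρ Z X ∘ₗ BT.tmulRight z = BT.rTensor D (BT.tmulRight z) ∘ₗ X.rho := rfl
      have h := BT.map_map (X.rho) (LinearMap.id : D →ₗ[B] D)
        (BT.rTensor D (BT.tmulRight (A := A) z)) LinearMap.id (X.rho x)
      rw [tensorρ_tmul, BT.map_map, e, ← h, BT.assoc_rTensor, X.rho_coassoc, BT.map_comm]
    | ha s t hs ht => simp only [map_add, hs, ht]
  counit t := by
    induction t using BT.induction_on with
    | h0 => simp
    | ht z x => rw [tensorρ_tmul, BT.map_comm, BT.rid_map, X.rho_counit]; rfl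
    | ha s t hs ht => simp only [map_add, hs, ht]

variable {Z} {Z' : Type u} [AddCommGroup Z'] [Module Aᵐᵒᵖ Z']

/-- `f ⊗_A X` as a morphism of comodules. -/
def tensorComodMap (f : Z →ₗ[Aᵐᵒᵖ] Z') : tensorComod Z X ⟶ tensorComod Z' X where
  lin := BT.rTensor X.carrier f
  comm t := by
    change BT.map _ _ (tensorρ Z X t) = tensorρ Z' X (BT.rTensor X.carrier f t)
    induction t using BT.induction_on with
    | h0 => simp
    | ht z x =>
      rw [tensorρ_tmul, BT.map_map]
      rfl
    | ha s t hs ht => simp only [map_add, hs, ht]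

end TensorComod

/-- The functor `- ⊗_A X : M_A → M^D`. -/
def tensorFunctor (X : ModComod k A B D) : ModuleCat.{u} Aᵐᵒᵖ ⥤ RComod B D where
  obj Z := tensorComod Z X
  map f := tensorComodMap X f.hom
  map_id Z := by
    ext t
    exact BT.map_id t
  map_comp f g := by
    ext t
    have h := BT.map_map f.hom (LinearMap.id : X.carrier →ₗ[A] X.carrier) g.hom LinearMap.id t
    exact h.symm

section TensorLam

variable (Z : Type u) [AddCommGroup Z] [Module Aᵐᵒᵖ Z] (X : Bicomod k A C B D)

/-- The map underlying `tensorLam`. -/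
def tensorLamLin : BT A Z X.carrier →ₗ[Bᵐᵒᵖ] BT A (BT A Z C) X.carrier where
  toFun t := (BT.assoc Z C X.carrier).symm (BT.map LinearMap.id X.lam t)
  map_add' s t := by rw [map_add, map_add]
  map_smul' b t := by
    rw [RingHom.id_apply, BT.map_smul_right _ X.lam X.lam_op, BT.assoc_symm_smul]

theorem tensorLamLin_tmul (z : Z) (x : X.carrier) :
    tensorLamLin Z X (BT.tmul A z x) = BT.map (BT.tmulRight z) LinearMap.id (X.lam x) := rfl

/-- For a right `A`-module `Z`, the morphism `Z ⊗_A X → Z ⊗_A (C ⊗_A X) ≅ (Z ⊗_A C) ⊗_A X` of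
right `D`-comodules given by the left coaction of `X`. -/
def tensorLam : tensorComod Z X.toModComod ⟶ tensorComod (BT A Z C) X.toModComod where
  lin := tensorLamLin Z X
  comm t := by
    change BT.map _ _ (tensorρ Z X.toModComod t) = tensorρ (BT A Z C) X.toModComod (tensorLamLin Z X t)
    induction t using BT.induction_on with
    | h0 => simp
    | ht z x =>
      have e : tensorLamLin Z X ∘ₗ BT.tmulRight z =
        BT.rTensor X.carrier (BT.tmulRight (A := A) (B := A) (N := C) z) ∘ₗ X.lamR := rfl
      have h := BT.map_map X.lamR (LinearMap.id : D →ₗ[B] D)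
        (BT.rTensor X.carrier (BT.tmulRight (A := A) (B := A) (N := C) z)) LinearMap.id (X.rho x)
      have h1 : BT.map X.lamR LinearMap.id (X.rho x) = tensorρ C X.toModComod (X.lam x) := by
        apply (BT.assoc C X.carrier D).injective
        exact (X.lam_rho x).trans ((BT.assoc C X.carrier D).apply_symm_apply _).symm
      have h2 := (tensorComodMap X.toModComod (BT.tmulRight (A := A) (B := A) (N := C) z)).comm (X.lam x)
      rw [tensorρ_tmul, BT.map_map, e]
      refine h.symm.trans ?_
      rw [h1]
      exact h2
    | ha s t hs ht => simp only [map_add, hs, ht]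

theorem tensorLam_naturality {Z' : Type u} [AddCommGroup Z'] [Module Aᵐᵒᵖ Z']
    (f : Z →ₗ[Aᵐᵒᵖ] Z') : tensorComodMap X.toModComod f ≫ tensorLam Z' X =
      tensorLam Z X ≫ tensorComodMap X.toModComod (BT.rTensor C f) := by
  ext t
  change tensorLamLin Z' X (BT.map f LinearMap.id t) =
    BT.map (BT.rTensor C f) LinearMap.id (tensorLamLin Z X t)
  induction t using BT.induction_on with
  | h0 => simp
  | ht z x =>
    rw [tensorLamLin_tmul, BT.map_map]
    rfl
  | ha s t hs ht => simp only [map_add, hs, ht]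

end TensorLam

end Bicomodules

section Kernel

variable {B : Type u} [Ring B] {D : Type u} [AddCommGroup D] [Module B D] [Module Bᵐᵒᵖ D]
  [SMulCommClass B Bᵐᵒᵖ D] [Coring B D]

theorem LeftFlat.map_injective (D : Type u) [AddCommGroup D] [Module B D] [LeftFlat B D]
    {M N : Type u} [AddCommGroup M] [Module Bᵐᵒᵖ M] [AddCommGroup N] [Module Bᵐᵒᵖ N]
    (f : M →ₗ[Bᵐᵒᵖ] N) (hf : Function.Injective f) :
    Function.Injective (BT.map f (LinearMap.id : D →ₗ[B] D)) := by
  have h : Function.Exact (0 : M →ₗ[Bᵐᵒᵖ] M) f := by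
    intro m
    constructor
    · intro hm
      exact ⟨0, (hf (by simpa using hm)).symm⟩
    · rintro ⟨_, rfl⟩
      simp
  rw [injective_iff_map_eq_zero]
  intro t ht
  obtain ⟨s, rfl⟩ := (LeftFlat.exact (D := D) _ _ _ _ _ h t).1 ht
  have h0 : BT.map (0 : M →ₗ[Bᵐᵒᵖ] M) (LinearMap.id : D →ₗ[B] D) = 0 :=
    BT.hom_ext fun m d => map_zero ((BT.mk B M D).flip d)
  rw [h0, AddMonoidHom.zero_apply]

variable [LeftFlat B D] {M N : RComod B D} (f : M ⟶ N)

theorem ker_exists (m : LinearMap.ker f.lin) :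
    M.ρ m ∈ LinearMap.range (BT.rTensor (B := B) D (LinearMap.ker f.lin).subtype) := by
  have h : Function.Exact (LinearMap.ker f.lin).subtype f.lin := by
    intro x
    simp
  apply (LeftFlat.exact (D := D) _ _ _ _ _ h _).1
  rw [f.comm, m.2, map_zero]

/-- The coaction of the kernel of `f`: the restriction of that of `M`, with values in
`ker f ⊗_B D ⊆ M ⊗_B D`. -/
noncomputable def kerρ : LinearMap.ker f.lin →ₗ[Bᵐᵒᵖ] BT B (LinearMap.ker f.lin) D :=
  (LinearEquiv.ofInjective (BT.rTensor (B := B) D (LinearMap.ker f.lin).subtype)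
    (LeftFlat.map_injective D _ Subtype.val_injective)).symm.toLinearMap ∘ₗ
  LinearMap.codRestrict _ (M.ρ ∘ₗ (LinearMap.ker f.lin).subtype) (ker_exists f)

theorem map_kerρ (m : LinearMap.ker f.lin) :
    BT.map (LinearMap.ker f.lin).subtype LinearMap.id (kerρ f m) = M.ρ m :=
  congrArg Subtype.val ((LinearEquiv.ofInjective (BT.rTensor (B := B) D (LinearMap.ker f.lin).subtype)
    (LeftFlat.map_injective D _ Subtype.val_injective)).apply_symm_apply ⟨_, ker_exists f m⟩)

/-- The kernel of a morphism of right comodules over a coring that is flat on the left. -/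
noncomputable abbrev kerComod : RComod B D where
  carrier := LinearMap.ker f.lin
  ρ := kerρ f
  coassoc m := by
    have hi := LeftFlat.map_injective D (BT.rTensor (B := B) D (LinearMap.ker f.lin).subtype)
      (LeftFlat.map_injective D _ Subtype.val_injective)
    have hj : Function.Injective (BT.map (LinearMap.ker f.lin).subtype
        (LinearMap.id : BT B D D →ₗ[B] BT B D D)) := by
      intro s t hst
      obtain ⟨s, rfl⟩ := (BT.assoc _ D D).surjective s
      obtain ⟨t, rfl⟩ := (BT.assoc _ D D).surjective t
      rw [← BT.assoc_rTensor, ← BT.assoc_rTensor] at hst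
      rw [hi ((BT.assoc _ D D).injective hst)]
    apply hj
    have e : BT.rTensor (B := B) D (LinearMap.ker f.lin).subtype ∘ₗ kerρ f =
        M.ρ ∘ₗ (LinearMap.ker f.lin).subtype := LinearMap.ext (map_kerρ f)
    have h := BT.map_map (LinearMap.ker f.lin).subtype (LinearMap.id : D →ₗ[B] D) M.ρ
      LinearMap.id (kerρ f m)
    rw [← BT.assoc_rTensor, BT.map_map, e, ← BT.map_comm, map_kerρ, ← M.coassoc, ← map_kerρ, h]
  counit m := by
    apply Subtype.ext
    change (LinearMap.ker f.lin).subtype _ = _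
    rw [← BT.rid_map, ← BT.map_comm, map_kerρ, M.counit]

/-- The inclusion of the kernel. -/
noncomputable def kerι : kerComod f ⟶ M where
  lin := (LinearMap.ker f.lin).subtype
  comm := map_kerρ f

theorem kerι_injective : Function.Injective (kerι f).lin := Subtype.val_injective

theorem kerι_comp : kerι f ≫ f = 0 := by
  ext m
  exact m.2

variable {f}

/-- A morphism killed by `f` factors through the kernel. -/
noncomputable def kerLift {P : RComod B D} (g : P ⟶ M) (h : g ≫ f = 0) : P ⟶ kerComod f where
  lin := LinearMap.codRestrict (LinearMap.ker f.lin) g.lin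
    (fun p => LinearMap.mem_ker.2 (congrArg (fun e => RComod.Hom.lin e p) h))
  comm p := by
    apply LeftFlat.map_injective D (LinearMap.ker f.lin).subtype Subtype.val_injective
    refine Eq.trans ?_ (map_kerρ f _).symm
    refine (BT.map_map _ _ _ _ _).trans ?_
    exact g.comm p

@[simp] theorem kerLift_ι {P : RComod B D} (g : P ⟶ M) (h : g ≫ f = 0) :
    kerLift g h ≫ kerι f = g := rfl

theorem ker_hom_ext {P : RComod B D} {g g' : P ⟶ kerComod f} (h : g ≫ kerι f = g' ≫ kerι f) :
    g = g' := by
  refine RComod.hom_ext fun p => ?_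
  exact kerι_injective f (congrArg (fun e => RComod.Hom.lin e p) h)

end Kernel

section Cotensor

variable {k : Type v} [CommRing k] {A : Type u} [Ring A] [Algebra k A]
  {C : Type u} [AddCommGroup C] [Module A C] [Module Aᵐᵒᵖ C] [SMulCommClass A Aᵐᵒᵖ C] [Coring A C]
  {B : Type u} [Ring B] [Algebra k B]
  {D : Type u} [AddCommGroup D] [Module B D] [Module Bᵐᵒᵖ D] [SMulCommClass B Bᵐᵒᵖ D] [Coring B D]

/-- The morphism `ω = ρ_Y ⊗_A X - Y ⊗_A λ_X : Y ⊗_A X → Y ⊗_A C ⊗_A X`. -/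
def cotensorω (Y : RComod A C) (X : Bicomod k A C B D) :
    tensorComod Y.carrier X.toModComod ⟶ tensorComod (BT A Y.carrier C) X.toModComod :=
  tensorComodMap X.toModComod Y.ρ - tensorLam Y.carrier X

theorem cotensorω_naturality {Y Y' : RComod A C} (g : Y ⟶ Y') (X : Bicomod k A C B D) :
    tensorComodMap X.toModComod g.lin ≫ cotensorω Y' X =
      cotensorω Y X ≫ tensorComodMap X.toModComod (BT.rTensor C g.lin) := by
  unfold cotensorω
  rw [Preadditive.comp_sub, Preadditive.sub_comp, tensorLam_naturality]
  congr 1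
  ext t
  change BT.map _ _ (BT.map _ _ t) = BT.map _ _ (BT.map _ _ t)
  refine (BT.map_map _ _ _ _ _).trans (Eq.trans ?_ (BT.map_map _ _ _ _ _).symm)
  have e : Y'.ρ ∘ₗ g.lin = BT.rTensor C g.lin ∘ₗ Y.ρ := LinearMap.ext fun m => (g.comm m).symm
  rw [e]

/-- The cotensor product functor `- □_C X : M^C → M^D`, where `Y □_C X` is the kernel of `ω`. -/
noncomputable def cotensor [LeftFlat B D] (X : Bicomod k A C B D) : RComod A C ⥤ RComod B D where
  obj Y := kerComod (cotensorω Y X)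
  map g := kerLift (kerι _ ≫ tensorComodMap X.toModComod g.lin) (by
    rw [Category.assoc, cotensorω_naturality, ← Category.assoc, kerι_comp, Limits.zero_comp])
  map_id Y := by
    apply ker_hom_ext
    ext t
    exact BT.map_id _
  map_comp f g := by
    apply ker_hom_ext
    ext t
    exact (BT.map_map f.lin LinearMap.id g.lin LinearMap.id
      ((kerι (cotensorω _ X)).lin t)).symm

end Cotensor

section Cohom

variable {k : Type v} [CommRing k] {A : Type u} [Ring A] [Algebra k A]
  {C : Type u} [AddCommGroup C] [Module A C] [Module Aᵐᵒᵖ C] [SMulCommClass A Aᵐᵒᵖ C] [Coring A C]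
  {B : Type u} [Ring B] [Algebra k B]
  {D : Type u} [AddCommGroup D] [Module B D] [Module Bᵐᵒᵖ D] [SMulCommClass B Bᵐᵒᵖ D] [Coring B D]

/-- `X` is quasi-finite as a right `D`-comodule: `- ⊗_A X : M_A → M^D` has a left adjoint. -/
def QuasiFinite (X : Bicomod k A C B D) : Prop := (tensorFunctor X.toModComod).IsRightAdjoint

/-- `X` is an injector as a right `D`-comodule: `- ⊗_A X : M_A → M^D` preserves injective
objects. -/
def Injector (X : Bicomod k A C B D) : Prop := (tensorFunctor X.toModComod).PreservesInjectiveObjects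

section Aux

variable (C) (Z : Type u) [AddCommGroup Z] [Module Aᵐᵒᵖ Z]

/-- `Z ⊗_A Δ`, with values in `(Z ⊗_A C) ⊗_A C`. -/
def comulLin : BT A Z C →ₗ[Aᵐᵒᵖ] BT A (BT A Z C) C where
  toFun t := (BT.assoc Z C C).symm (BT.map LinearMap.id Coring.Δ t)
  map_add' s t := by rw [map_add, map_add]
  map_smul' b t := by
    rw [RingHom.id_apply, BT.map_smul_right _ Coring.Δ Coring.Δ_op, BT.assoc_symm_smul]

/-- `Z ⊗_A ε`, with values in `Z`. -/
def counitLin : BT A Z C →ₗ[Aᵐᵒᵖ] Z where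
  toFun t := BT.rid (BT.map LinearMap.id Coring.ε t)
  map_add' s t := by rw [map_add, map_add]
  map_smul' b t := by
    rw [RingHom.id_apply, BT.map_smul_right _ (Coring.ε (A := A) (C := C)) Coring.ε_op]
    generalize BT.map LinearMap.id (Coring.ε (A := A) (C := C)) t = s
    induction s using BT.induction_on with
    | h0 => simp
    | ht z a =>
      induction b using MulOpposite.rec' with
      | h b => simp [mul_smul]
    | ha x y hx hy => simp only [smul_add, map_add, hx, hy]

variable {C} (X : Bicomod k A C B D)

theorem map_comulLin (t : BT A Z X.carrier) :
    BT.map (comulLin C Z) LinearMap.id (tensorLamLin Z X t) =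
      tensorLamLin (BT A Z C) X (tensorLamLin Z X t) := by
  induction t using BT.induction_on with
  | h0 => simp
  | ht z x =>
    have h1 : tensorLamLin C X (X.lam x) =
        BT.map (relin Coring.Δ Coring.Δ_op) LinearMap.id (X.lam x) := by
      apply (BT.assoc C C X.carrier).injective
      exact ((BT.assoc C C X.carrier).apply_symm_apply _).trans (X.lam_coassoc x).symm
    have h2 := congrArg (fun e => RComod.Hom.lin e (X.lam x))
      (tensorLam_naturality (Z := C) X (BT.tmulRight (A := A) (B := A) (N := C) z))
    have h3 : tensorLamLin (BT A Z C) X (BT.map (BT.tmulRight z) LinearMap.id (X.lam x)) =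
      BT.map (BT.rTensor C (BT.tmulRight z)) LinearMap.id (tensorLamLin C X (X.lam x)) := h2
    rw [tensorLamLin_tmul, h3, h1, BT.map_map, BT.map_map]
    rfl
  | ha s t hs ht => simp only [map_add, hs, ht]

theorem map_counitLin (t : BT A Z X.carrier) :
    BT.map (counitLin C Z) LinearMap.id (tensorLamLin Z X t) = t := by
  induction t using BT.induction_on with
  | h0 => simp
  | ht z x =>
    have h : ∀ s : BT A C X.carrier,
        BT.map (counitLin C Z ∘ₗ BT.tmulRight z) LinearMap.id s =
          BT.tmul A z (BT.lid (BT.map (relin Coring.ε Coring.ε_op) LinearMap.id s)) := by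
      intro s
      induction s using BT.induction_on with
      | h0 => simpa using (map_zero (BT.mk A Z X.carrier z)).symm
      | ht c x => exact BT.smul_tmul _ _ _
      | ha s t hs ht => simp only [map_add, hs, ht, BT.tmul_add]
    rw [tensorLamLin_tmul, BT.map_map]
    refine (h _).trans ?_
    rw [X.lam_counit]
  | ha s t hs ht => simp only [map_add, hs, ht]

theorem tensorLamLin_map {Z' : Type u} [AddCommGroup Z'] [Module Aᵐᵒᵖ Z'] (f : Z →ₗ[Aᵐᵒᵖ] Z')
    (t : BT A Z X.carrier) : tensorLamLin Z' X (BT.map f LinearMap.id t) =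
      BT.map (BT.rTensor C f) LinearMap.id (tensorLamLin Z X t) :=
  congrArg (fun e => RComod.Hom.lin e t) (tensorLam_naturality Z X f)

end Aux

section Functor

variable (X : Bicomod k A C B D) (hX : QuasiFinite X)

/-- The co-hom functor with values in modules: the left adjoint `M^D → M_A` of `- ⊗_A X`. -/
noncomputable def cohomMod : RComod B D ⥤ ModuleCat.{u} Aᵐᵒᵖ :=
  haveI : (tensorFunctor X.toModComod).IsRightAdjoint := hX
  (tensorFunctor X.toModComod).leftAdjoint

/-- The adjunction defining the co-hom functor. -/
noncomputable def cohomModAdj : cohomMod X hX ⊣ tensorFunctor X.toModComod :=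
  haveI : (tensorFunctor X.toModComod).IsRightAdjoint := hX
  Adjunction.ofIsRightAdjoint (tensorFunctor X.toModComod)

/-- The unit `M → h_D(X, M) ⊗_A X`. -/
noncomputable def cohomUnit (M : RComod B D) : M ⟶ tensorComod ((cohomMod X hX).obj M) X.toModComod :=
  (cohomModAdj X hX).unit.app M

theorem cohomUnit_naturality {M N : RComod B D} (f : M ⟶ N) (m : M.carrier) :
    BT.map ((cohomMod X hX).map f).hom LinearMap.id ((cohomUnit X hX M).lin m) =
      (cohomUnit X hX N).lin (f.lin m) :=
  (congrArg (fun e => RComod.Hom.lin e m) ((cohomModAdj X hX).unit.naturality f)).symm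

/-- The linear map `h_D(X, M) → Z` corresponding to a morphism `M → Z ⊗_A X`. -/
noncomputable def cohomDesc {M : RComod B D} {Z : Type u} [AddCommGroup Z] [Module Aᵐᵒᵖ Z]
    (g : M ⟶ tensorComod Z X.toModComod) : (cohomMod X hX).obj M →ₗ[Aᵐᵒᵖ] Z :=
  (((cohomModAdj X hX).homEquiv M (ModuleCat.of _ Z)).symm g).hom

theorem cohomDesc_unit {M : RComod B D} {Z : Type u} [AddCommGroup Z] [Module Aᵐᵒᵖ Z]
    (g : M ⟶ tensorComod Z X.toModComod) (m : M.carrier) :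
    BT.map (cohomDesc X hX g) LinearMap.id ((cohomUnit X hX M).lin m) = g.lin m := by
  have h := ((cohomModAdj X hX).homEquiv M (ModuleCat.of _ Z)).apply_symm_apply g
  rw [Adjunction.homEquiv_unit] at h
  exact congrArg (fun e => RComod.Hom.lin e m) h

theorem cohom_ext {M : RComod B D} {Z : Type u} [AddCommGroup Z] [Module Aᵐᵒᵖ Z]
    {f g : (cohomMod X hX).obj M →ₗ[Aᵐᵒᵖ] Z}
    (h : ∀ m, BT.map f LinearMap.id ((cohomUnit X hX M).lin m) =
      BT.map g LinearMap.id ((cohomUnit X hX M).lin m)) : f = g := by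
  have : ModuleCat.ofHom f = ModuleCat.ofHom g := by
    apply ((cohomModAdj X hX).homEquiv M (ModuleCat.of _ Z)).injective
    rw [Adjunction.homEquiv_unit, Adjunction.homEquiv_unit]
    ext m
    exact h m
  exact congrArg ModuleCat.Hom.hom this

/-- The coaction `h_D(X, M) → h_D(X, M) ⊗_A C`, corresponding under the adjunction to
`M → h_D(X, M) ⊗_A X → h_D(X, M) ⊗_A C ⊗_A X`. -/
noncomputable def cohomρ (M : RComod B D) :
    (cohomMod X hX).obj M →ₗ[Aᵐᵒᵖ] BT A ((cohomMod X hX).obj M) C :=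
  cohomDesc X hX (cohomUnit X hX M ≫ tensorLam _ X)

theorem cohomρ_unit (M : RComod B D) (m : M.carrier) :
    BT.map (cohomρ X hX M) LinearMap.id ((cohomUnit X hX M).lin m) =
      tensorLamLin _ X ((cohomUnit X hX M).lin m) :=
  cohomDesc_unit X hX _ m

/-- The right `C`-comodule `h_D(X, M)`. -/
noncomputable abbrev cohomObj (M : RComod B D) : RComod A C where
  carrier := (cohomMod X hX).obj M
  ρ := cohomρ X hX M
  coassoc := by
    have h : BT.rTensor C (cohomρ X hX M) ∘ₗ cohomρ X hX M =
        comulLin C _ ∘ₗ cohomρ X hX M := by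
      apply cohom_ext
      intro m
      have h1 := BT.map_map (cohomρ X hX M) (LinearMap.id : X.carrier →ₗ[A] X.carrier)
        (BT.rTensor C (cohomρ X hX M)) LinearMap.id ((cohomUnit X hX M).lin m)
      have h2 := BT.map_map (cohomρ X hX M) (LinearMap.id : X.carrier →ₗ[A] X.carrier)
        (comulLin C _) LinearMap.id ((cohomUnit X hX M).lin m)
      refine h1.symm.trans (Eq.trans ?_ h2)
      rw [cohomρ_unit, map_comulLin, ← tensorLamLin_map, cohomρ_unit]
    intro m
    apply (BT.assoc _ C C).symm.injective
    rw [AddEquiv.symm_apply_apply]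
    exact LinearMap.congr_fun h m
  counit := by
    have h : counitLin C _ ∘ₗ cohomρ X hX M = LinearMap.id := by
      apply cohom_ext
      intro m
      have h2 := BT.map_map (cohomρ X hX M) (LinearMap.id : X.carrier →ₗ[A] X.carrier)
        (counitLin C _) LinearMap.id ((cohomUnit X hX M).lin m)
      refine h2.symm.trans ?_
      rw [cohomρ_unit, map_counitLin]
      exact (BT.map_id _).symm
    exact fun m => LinearMap.congr_fun h m

/-- The co-hom functor `h_D(X, -) : M^D → M^C` of a quasi-finite `X`. -/
noncomputable def cohom : RComod B D ⥤ RComod A C where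
  obj M := cohomObj X hX M
  map {M N} f :=
    { lin := ((cohomMod X hX).map f).hom
      comm := by
        have h : BT.rTensor C ((cohomMod X hX).map f).hom ∘ₗ cohomρ X hX M =
            cohomρ X hX N ∘ₗ ((cohomMod X hX).map f).hom := by
          apply cohom_ext
          intro m
          refine (BT.map_map _ LinearMap.id _ LinearMap.id _).symm.trans
            (Eq.trans ?_ (BT.map_map _ LinearMap.id _ LinearMap.id _))
          rw [cohomρ_unit, ← tensorLamLin_map, cohomUnit_naturality, cohomρ_unit]
        exact fun m => LinearMap.congr_fun h m }
  map_id M := by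
    ext m
    exact congrArg (fun e => ModuleCat.Hom.hom e m) ((cohomMod X hX).map_id M)
  map_comp f g := by
    ext m
    exact congrArg (fun e => ModuleCat.Hom.hom e m) ((cohomMod X hX).map_comp f g)

theorem cohom_key {M : RComod B D} {Y : RComod A C} (q : (cohomMod X hX).obj M →ₗ[Aᵐᵒᵖ] Y.carrier) :
    BT.rTensor C q ∘ₗ cohomρ X hX M = Y.ρ ∘ₗ q ↔
      ∀ m, (cotensorω Y X).lin (BT.map q LinearMap.id ((cohomUnit X hX M).lin m)) = 0 := by
  have h : ∀ m, (cotensorω Y X).lin (BT.map q LinearMap.id ((cohomUnit X hX M).lin m)) =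
      BT.map (Y.ρ ∘ₗ q) LinearMap.id ((cohomUnit X hX M).lin m) -
        BT.map (BT.rTensor C q ∘ₗ cohomρ X hX M) LinearMap.id ((cohomUnit X hX M).lin m) := by
    intro m
    have h1 := BT.map_map q (LinearMap.id : X.carrier →ₗ[A] X.carrier) Y.ρ LinearMap.id
      ((cohomUnit X hX M).lin m)
    have h2 := BT.map_map (cohomρ X hX M) (LinearMap.id : X.carrier →ₗ[A] X.carrier)
      (BT.rTensor C q) LinearMap.id ((cohomUnit X hX M).lin m)
    rw [cohomρ_unit, ← tensorLamLin_map] at h2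
    rw [LinearMap.id_comp] at h1 h2
    rw [← h1, ← h2, cotensorω, RComod.sub_lin]
    rfl
  constructor
  · intro hq m
    rw [h, hq, sub_self]
  · intro hq
    apply cohom_ext
    intro m
    exact (sub_eq_zero.1 ((h m).symm.trans (hq m))).symm

/-- `h_D(X, -)` is left adjoint to `- □_C X`. -/
noncomputable def cohomAdj [LeftFlat B D] : cohom X hX ⊣ cotensor X :=
  Adjunction.mkOfHomEquiv
    { homEquiv := fun M Y =>
        { toFun := fun g => kerLift (cohomUnit X hX M ≫ tensorComodMap X.toModComod g.lin) (by
            ext m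
            exact (cohom_key X hX g.lin).1 (LinearMap.ext g.comm) m)
          invFun := fun h =>
            { lin := cohomDesc X hX (h ≫ kerι _)
              comm := LinearMap.congr_fun ((cohom_key X hX _).2 (fun m => by
                rw [cohomDesc_unit]
                exact (h.lin m).2)) }
          left_inv := fun g => by
            ext m
            refine LinearMap.congr_fun (?_ : cohomDesc X hX _ = g.lin) m
            apply cohom_ext
            intro m
            rw [cohomDesc_unit]
            rfl
          right_inv := fun h => by
            apply ker_hom_ext
            ext m
            exact cohomDesc_unit X hX _ m }
      homEquiv_naturality_left_symm := fun {M' M Y} f g => by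
        ext m
        refine LinearMap.congr_fun (?_ : cohomDesc X hX _ =
          cohomDesc X hX (g ≫ kerι _) ∘ₗ ((cohomMod X hX).map f).hom) m
        apply cohom_ext
        intro m
        refine Eq.trans ?_ (BT.map_map _ LinearMap.id _ LinearMap.id _)
        rw [cohomDesc_unit, cohomUnit_naturality, cohomDesc_unit]
        rfl
      homEquiv_naturality_right := fun {M Y Y'} f g => by
        apply ker_hom_ext
        ext m
        exact (BT.map_map _ LinearMap.id _ LinearMap.id _).symm }

theorem cohom_isLeftAdjoint [LeftFlat B D] : (cohom X hX).IsLeftAdjoint :=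
  (cohomAdj X hX).isLeftAdjoint

instance : (cohom X hX).Additive where
  map_add {M N f g} := by
    ext m
    refine LinearMap.congr_fun (?_ : ((cohomMod X hX).map (f + g)).hom =
      ((cohomMod X hX).map f).hom + ((cohomMod X hX).map g).hom) m
    apply cohom_ext
    intro m
    rw [cohomUnit_naturality, BT.map_add_left, cohomUnit_naturality, cohomUnit_naturality]
    exact map_add _ _ _

instance [CentralBimodule k A A C] [CentralBimodule k B B D] : (cohom X hX).Linear k where
  map_smul {M N} f r := by
    ext m
    refine LinearMap.congr_fun (?_ : ((cohomMod X hX).map (r • f)).hom =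
      RComod.scalar k r ∘ₗ ((cohomMod X hX).map f).hom) m
    apply cohom_ext
    intro m
    refine Eq.trans ?_ (BT.map_map _ LinearMap.id _ LinearMap.id _)
    rw [cohomUnit_naturality, cohomUnit_naturality, RComod.smul_lin, map_smul]
    generalize (cohomUnit X hX N).lin (f.lin m) = t
    induction t using BT.induction_on with
    | h0 => simp
    | ht z x =>
      rw [BT.smul_tmul_right, ← CentralBimodule.central (A := A)]
      exact (BT.smul_tmul _ _ _).symm
    | ha s t hs ht => rw [map_add, smul_add, hs, ht]

end Functor

end Cohom

section Induced

variable {k : Type v} [CommRing k] {R : Type u} [Ring R] [Algebra k R]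
  {A : Type u} [Ring A] [Algebra k A]
  {C : Type u} [AddCommGroup C] [Module A C] [Module Aᵐᵒᵖ C] [SMulCommClass A Aᵐᵒᵖ C] [Coring A C]
  {B : Type u} [Ring B] [Algebra k B]
  {D : Type u} [AddCommGroup D] [Module B D] [Module Bᵐᵒᵖ D] [SMulCommClass B Bᵐᵒᵖ D] [Coring B D]

section TensorHom

variable (M : ModComod k R A C)

/-- The left action of `r` on an `R`-`C`-bicomodule is an endomorphism of the right comodule. -/
def actHom (r : R) : M.toRComod ⟶ M.toRComod where
  lin := BT.lmul r
  comm m := (M.rho_smul r m).symm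

variable (Y : Type u) [AddCommGroup Y] [Module Rᵐᵒᵖ Y]

/-- The morphism `y ⊗ - : M → Y ⊗_R M` of right comodules. -/
def tmulHom {Y : Type u} [AddCommGroup Y] [Module Rᵐᵒᵖ Y] (y : Y) :
    M.toRComod ⟶ tensorComod Y M where
  lin := BT.tmulRight y
  comm _ := rfl

theorem tmulHom_add (y y' : Y) : tmulHom M (y + y') = tmulHom M y + tmulHom M y' := by
  ext m
  exact BT.add_tmul y y' m

theorem tmulHom_smul (r : R) (y : Y) : tmulHom M (op r • y) = actHom M r ≫ tmulHom M y := by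
  ext m
  exact BT.smul_tmul r y m

variable {Y}

/-- A balanced additive family of morphisms `φ y : M → N` induces a morphism `Y ⊗_R M → N`. -/
def tensorDesc {N : RComod A C} (φ : Y → (M.toRComod ⟶ N)) (ha : ∀ y y', φ (y + y') = φ y + φ y')
    (hs : ∀ (r : R) (y : Y), φ (op r • y) = actHom M r ≫ φ y) : tensorComod Y M ⟶ N where
  lin :=
    { toFun := BT.lift (AddMonoidHom.mk' (fun y => (φ y).lin.toAddMonoidHom)
        (fun y y' => by ext m; exact congrArg (fun e => RComod.Hom.lin e m) (ha y y')))
        (fun y r m => congrArg (fun e => RComod.Hom.lin e m) (hs r y))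
      map_add' := map_add _
      map_smul' := fun b t => by
        induction t using BT.induction_on with
        | h0 => simp
        | ht y m => exact map_smul (φ y).lin b m
        | ha s t hs ht => simp only [smul_add, map_add, hs, ht] }
  comm t := by
    induction t using BT.induction_on with
    | h0 => simp
    | ht y m =>
      refine (BT.map_map _ LinearMap.id _ LinearMap.id _).trans ?_
      exact (φ y).comm m
    | ha s t hs ht => simp only [map_add, hs, ht]

@[simp] theorem tmulHom_desc {N : RComod A C} (φ : Y → (M.toRComod ⟶ N)) (ha) (hs) (y : Y) :
    tmulHom M y ≫ tensorDesc M φ ha hs = φ y := rfl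

theorem tensor_hom_ext {N : RComod A C} {f g : tensorComod Y M ⟶ N}
    (h : ∀ y : Y, tmulHom M y ≫ f = tmulHom M y ≫ g) : f = g := by
  refine RComod.hom_ext fun t => ?_
  induction t using BT.induction_on with
  | h0 => simp
  | ht y m => exact congrArg (fun e => RComod.Hom.lin e m) (h y)
  | ha s t hs ht => simp only [map_add, hs, ht]

theorem tmulHom_map {Y' : Type u} [AddCommGroup Y'] [Module Rᵐᵒᵖ Y'] (f : Y →ₗ[Rᵐᵒᵖ] Y') (y : Y) :
    tmulHom M y ≫ tensorComodMap M f = tmulHom M (f y) := rfl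

end TensorHom

variable (F : RComod A C ⥤ RComod B D) [F.Additive]

/-- For an `R`-`C`-bicomodule `M`, the left action of `r ∈ R` on `F(M)` by `F(r · -)`. -/
instance inducedModule (M : ModComod k R A C) : Module R (F.obj M.toRComod).carrier :=
  { smul := fun r x => (F.map (actHom M r)).lin x
    one_smul := fun x => by
      change (F.map (actHom M 1)).lin x = x
      have : actHom M (1 : R) = 𝟙 _ := by ext m; exact one_smul R m
      rw [this, F.map_id]
      rfl
    mul_smul := fun r s x => by
      change (F.map (actHom M (r * s))).lin x = (F.map (actHom M r)).lin
        ((F.map (actHom M s)).lin x)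
      have : actHom M (r * s) = actHom M s ≫ actHom M r := by ext m; exact mul_smul r s m
      rw [this, F.map_comp]
      rfl
    smul_zero := fun r => map_zero _
    smul_add := fun r => map_add _
    add_smul := fun r s x => by
      change (F.map (actHom M (r + s))).lin x = (F.map (actHom M r)).lin x +
        (F.map (actHom M s)).lin x
      have : actHom M (r + s) = actHom M r + actHom M s := by ext m; exact add_smul r s m
      rw [this, F.map_add]
      rfl
    zero_smul := fun x => by
      change (F.map (actHom M 0)).lin x = 0
      have : actHom M (0 : R) = 0 := by ext m; exact zero_smul R m
      rw [this, F.map_zero]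
      rfl }

instance inducedSMulComm (M : ModComod k R A C) :
    SMulCommClass R Bᵐᵒᵖ (F.obj M.toRComod).carrier :=
  ⟨fun r b x => map_smul (F.map (actHom M r)).lin b x⟩

variable [CentralBimodule k A A C] [CentralBimodule k B B D] [F.Linear k]

/-- For an `R`-`C`-bicomodule `M` and a `k`-linear functor `F : M^C → M^D`, the `R`-`D`-bicomodule
`F(M)`, where `r ∈ R` acts by `F(r · -)`. -/
abbrev inducedModComod (M : ModComod k R A C) : ModComod k R B D :=
  { carrier := (F.obj M.toRComod).carrier
    central := ⟨fun r x => by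
      have : actHom M (algebraMap k R r) = r • 𝟙 _ := by
        ext m
        exact CentralBimodule.central r m
      change (F.map (actHom M (algebraMap k R r))).lin x = _
      rw [this, F.map_smul, F.map_id]
      rfl⟩
    rho := (F.obj M.toRComod).ρ
    rho_smul := fun r x => ((F.map (actHom M r)).comm x).symm
    rho_coassoc := (F.obj M.toRComod).coassoc
    rho_counit := (F.obj M.toRComod).counit }

theorem actHom_induced (M : ModComod k R A C) (r : R) :
    actHom (inducedModComod F M) r = F.map (actHom M r) := rfl

variable {Y : Type u} [AddCommGroup Y] [Module Rᵐᵒᵖ Y]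

variable (Y) in
/-- The natural morphism `Υ_{Y,M} : Y ⊗_R F(M) → F(Y ⊗_R M)`, `y ⊗ x ↦ F(y ⊗ -)(x)`. -/
def upsilon (M : ModComod k R A C) :
    tensorComod Y (inducedModComod F M) ⟶ F.obj (tensorComod Y M) :=
  tensorDesc (inducedModComod F M) (fun y => F.map (tmulHom M y))
    (fun y y' => by rw [tmulHom_add, F.map_add])
    (fun r y => by rw [tmulHom_smul, F.map_comp]; rfl)

theorem tmulHom_upsilon (M : ModComod k R A C) (y : Y) :
    tmulHom (inducedModComod F M) y ≫ upsilon F Y M = F.map (tmulHom M y) := rfl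

theorem upsilon_naturality (M : ModComod k R A C) {Y' : Type u} [AddCommGroup Y']
    [Module Rᵐᵒᵖ Y'] (f : Y →ₗ[Rᵐᵒᵖ] Y') :
    tensorComodMap (inducedModComod F M) f ≫ upsilon F Y' M =
      upsilon F Y M ≫ F.map (tensorComodMap M f) := by
  apply tensor_hom_ext
  intro y
  rw [← Category.assoc, ← Category.assoc, tmulHom_map, tmulHom_upsilon, tmulHom_upsilon,
    ← F.map_comp, tmulHom_map]

/-- `Υ` is an isomorphism when `F` has a right adjoint. -/
theorem upsilon_isIso (hF : F.IsLeftAdjoint) (M : ModComod k R A C) : IsIso (upsilon F Y M) := by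
  obtain ⟨G, ⟨adj⟩⟩ := hF
  let Ψ : tensorComod Y M ⟶ G.obj (tensorComod Y (inducedModComod F M)) :=
    tensorDesc M (fun y => adj.homEquiv _ _ (tmulHom (inducedModComod F M) y))
      (fun y y' => by rw [tmulHom_add, adj.homAddEquiv_add])
      (fun r y => by rw [tmulHom_smul, actHom_induced, adj.homEquiv_naturality_left])
  have hΨ : ∀ y, tmulHom M y ≫ Ψ = adj.homEquiv _ _ (tmulHom (inducedModComod F M) y) :=
    fun y => rfl
  refine ⟨(adj.homEquiv _ _).symm Ψ, ?_, ?_⟩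
  · apply tensor_hom_ext
    intro y
    rw [← Category.assoc, tmulHom_upsilon, ← adj.homEquiv_naturality_left_symm, hΨ,
      Equiv.symm_apply_apply, Category.comp_id]
  · apply (adj.homEquiv _ _).injective
    apply tensor_hom_ext
    intro y
    rw [← adj.homEquiv_naturality_right_symm, Equiv.apply_symm_apply, ← Category.assoc, hΨ,
      ← adj.homEquiv_naturality_right, tmulHom_upsilon, ← adj.homEquiv_naturality_left,
      Category.comp_id]

section Bicomodule

variable {E : Type u} [AddCommGroup E] [Module R E] [Module Rᵐᵒᵖ E] [SMulCommClass R Rᵐᵒᵖ E]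
  [Coring R E]

/-- The left coaction of a bicomodule as a morphism `M → E ⊗_R M` of right comodules. -/
def lamHom (M : Bicomod k R E A C) : M.toRComod ⟶ tensorComod E M.toModComod where
  lin := M.lamR
  comm x := by
    apply (BT.assoc E M.carrier C).injective
    exact (M.lam_rho x).trans ((BT.assoc E M.carrier C).apply_symm_apply _).symm

variable (hF : F.IsLeftAdjoint) (M : Bicomod k R E A C)

/-- The left coaction `F(M) → F(E ⊗_R M) ≅ E ⊗_R F(M)`, that is `Υ⁻¹ ∘ F(λ_M)`. -/
noncomputable def inducedLam : F.obj M.toRComod ⟶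
    tensorComod E (inducedModComod F M.toModComod) :=
  haveI := upsilon_isIso (Y := E) F hF M.toModComod
  F.map (lamHom M) ≫ inv (upsilon F E M.toModComod)

theorem inducedLam_upsilon :
    inducedLam F hF M ≫ upsilon F E M.toModComod = F.map (lamHom M) := by
  have := upsilon_isIso (Y := E) F hF M.toModComod
  rw [inducedLam, Category.assoc, IsIso.inv_hom_id, Category.comp_id]

theorem upsilon_cancel (hF : F.IsLeftAdjoint) {Y : Type u} [AddCommGroup Y] [Module Rᵐᵒᵖ Y] {P : RComod B D}
    (N : ModComod k R A C) {f g : P ⟶ tensorComod Y (inducedModComod F N)}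
    (h : f ≫ upsilon F Y N = g ≫ upsilon F Y N) : f = g := by
  have := upsilon_isIso (Y := Y) F hF N
  exact (cancel_mono _).1 h

theorem inducedLam_act (r : R) :
    F.map (actHom M.toModComod r) ≫ inducedLam F hF M =
      inducedLam F hF M ≫ tensorComodMap _ (BT.lmul r) := by
  apply upsilon_cancel F hF
  rw [Category.assoc, Category.assoc, inducedLam_upsilon, upsilon_naturality,
    ← Category.assoc, inducedLam_upsilon, ← F.map_comp, ← F.map_comp]
  congr 1
  ext m
  exact map_smul M.lam r m

/-- `E ⊗_R λ_{F(M)}` as a morphism of right comodules. -/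
noncomputable def inducedTensorLam : tensorComod E (inducedModComod F M.toModComod) ⟶
    tensorComod (BT R E E) (inducedModComod F M.toModComod) :=
  tensorDesc _ (fun e => inducedLam F hF M ≫ tensorComodMap _ (BT.tmulRight e))
    (fun e e' => by
      rw [← Preadditive.comp_add]
      congr 1
      ext t
      have h : (BT.tmulRight (e + e') : E →ₗ[Rᵐᵒᵖ] BT R E E) =
        BT.tmulRight e + BT.tmulRight e' := LinearMap.ext fun x => BT.add_tmul e e' x
      rw [h]
      exact BT.map_add_left _ _ _ t)
    (fun r e => by
      rw [actHom_induced, ← Category.assoc, inducedLam_act, Category.assoc]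
      congr 1
      ext t
      refine Eq.trans ?_ (BT.map_map _ LinearMap.id _ LinearMap.id t).symm
      have h : (BT.tmulRight (op r • e) : E →ₗ[Rᵐᵒᵖ] BT R E E) =
        BT.tmulRight e ∘ₗ BT.lmul r := LinearMap.ext fun x => BT.smul_tmul r e x
      exact congrArg (fun g => BT.map g LinearMap.id t) h)

theorem inducedLam_coassoc : inducedLam F hF M ≫ inducedTensorLam F hF M =
    inducedLam F hF M ≫ tensorComodMap _ (relin Coring.Δ Coring.Δ_op) := by
  have h1 : inducedTensorLam F hF M ≫ upsilon F (BT R E E) M.toModComod =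
      upsilon F E M.toModComod ≫ F.map (tensorLam E M) := by
    apply tensor_hom_ext
    intro e
    have e1 : tmulHom (inducedModComod F M.toModComod) e ≫ inducedTensorLam F hF M =
      inducedLam F hF M ≫ tensorComodMap _ (BT.tmulRight e) := rfl
    have e2 : tmulHom M.toModComod e ≫ tensorLam E M =
      lamHom M ≫ tensorComodMap _ (BT.tmulRight e) := rfl
    rw [← Category.assoc, ← Category.assoc, e1, tmulHom_upsilon, ← F.map_comp, e2, F.map_comp,
      ← inducedLam_upsilon F hF, Category.assoc, Category.assoc, upsilon_naturality]
  have h2 : lamHom M ≫ tensorLam E M =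
      lamHom M ≫ tensorComodMap _ (relin Coring.Δ Coring.Δ_op) := by
    ext x
    apply (BT.assoc E E M.carrier).injective
    exact ((BT.assoc E E M.carrier).apply_symm_apply _).trans (M.lam_coassoc x).symm
  apply upsilon_cancel F hF
  rw [Category.assoc, Category.assoc, h1, upsilon_naturality, ← Category.assoc, ← Category.assoc,
    inducedLam_upsilon, ← F.map_comp, ← F.map_comp, h2]

/-- `ε ⊗_R N : E ⊗_R N → N` as a morphism of right comodules. -/
def counitHom (E : Type u) [AddCommGroup E] [Module R E] [Module Rᵐᵒᵖ E]
    [SMulCommClass R Rᵐᵒᵖ E] [Coring R E] (N : ModComod k R A C) :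
    tensorComod E N ⟶ N.toRComod :=
  tensorDesc N (fun e => actHom N (Coring.ε e))
    (fun e e' => by ext m; exact (congrArg (· • m) (map_add _ _ _)).trans (add_smul _ _ _))
    (fun r e => by
      ext m
      refine (congrArg (· • m) (Coring.ε_op (op r) e)).trans ?_
      exact mul_smul _ _ _)

theorem inducedLam_counit : inducedLam F hF M ≫ counitHom E (inducedModComod F M.toModComod) =
    𝟙 _ := by
  have h1 : counitHom E (inducedModComod F M.toModComod) =
      upsilon F E M.toModComod ≫ F.map (counitHom E M.toModComod) := by
    apply tensor_hom_ext
    intro e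
    rw [← Category.assoc, tmulHom_upsilon, ← F.map_comp]
    rfl
  have h2 : lamHom M ≫ counitHom E M.toModComod = 𝟙 _ := by
    ext x
    refine Eq.trans ?_ (M.lam_counit x)
    change (counitHom E M.toModComod).lin (M.lam x) = _
    generalize M.lam x = t
    induction t using BT.induction_on with
    | h0 => simp
    | ht e m => rfl
    | ha s t hs ht => simp only [map_add, hs, ht]
  rw [h1, ← Category.assoc, inducedLam_upsilon, ← F.map_comp, h2, F.map_id]

/-- For an `E`-`C`-bicomodule `M` and a `k`-linear left adjoint functor `F : M^C → M^D`, the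
`E`-`D`-bicomodule `F(M)`: the base ring of `E` acts by `F(r · -)`, and the left coaction is
`Υ⁻¹ ∘ F(λ_M)`. -/
noncomputable def induced : Bicomod k R E B D where
  toModComod := inducedModComod F M.toModComod
  lam :=
    { toFun := (inducedLam F hF M).lin
      map_add' := map_add _
      map_smul' := fun r x =>
        congrArg (fun e => RComod.Hom.lin e x) (inducedLam_act F hF M r) }
  lam_op b x := map_smul (inducedLam F hF M).lin b x
  lam_coassoc x := by
    apply (BT.assoc E E _).symm.injective
    rw [AddEquiv.symm_apply_apply]
    refine (congrArg (fun e => RComod.Hom.lin e x) (inducedLam_coassoc F hF M)).symm.trans ?_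
    change (inducedTensorLam F hF M).lin ((inducedLam F hF M).lin x) = _
    change _ = (BT.assoc E E _).symm (BT.map LinearMap.id _ ((inducedLam F hF M).lin x))
    generalize (inducedLam F hF M).lin x = t
    induction t using BT.induction_on with
    | h0 => simp
    | ht e m => rfl
    | ha s t hs ht => simp only [map_add, hs, ht]
  lam_counit x := by
    refine Eq.trans ?_ (congrArg (fun e => RComod.Hom.lin e x) (inducedLam_counit F hF M))
    change _ = (counitHom E (inducedModComod F M.toModComod)).lin ((inducedLam F hF M).lin x)
    change BT.lid (BT.map _ LinearMap.id ((inducedLam F hF M).lin x)) = _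
    generalize (inducedLam F hF M).lin x = t
    induction t using BT.induction_on with
    | h0 => simp
    | ht e m => rfl
    | ha s t hs ht => simp only [map_add, hs, ht]
  lam_rho x := by
    apply (BT.assoc E _ D).symm.injective
    rw [AddEquiv.symm_apply_apply]
    exact (inducedLam F hF M).comm x

end Bicomodule

end Induced

section Frobenius

/-- `(F, G)` is a Frobenius pair: `G` is both a right and a left adjoint of `F`. -/
structure IsFrobeniusPair {𝒞 𝒟 : Type*} [Category 𝒞] [Category 𝒟] (F : 𝒞 ⥤ 𝒟) (G : 𝒟 ⥤ 𝒞) :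
    Prop where
  left_right : Nonempty (F ⊣ G)
  right_left : Nonempty (G ⊣ F)

theorem IsFrobeniusPair.isLeftAdjoint_left {𝒞 𝒟 : Type*} [Category 𝒞] [Category 𝒟] {F : 𝒞 ⥤ 𝒟}
    {G : 𝒟 ⥤ 𝒞} (h : IsFrobeniusPair F G) : F.IsLeftAdjoint := ⟨G, h.left_right⟩

theorem IsFrobeniusPair.isLeftAdjoint_right {𝒞 𝒟 : Type*} [Category 𝒞] [Category 𝒟] {F : 𝒞 ⥤ 𝒟}
    {G : 𝒟 ⥤ 𝒞} (h : IsFrobeniusPair F G) : G.IsLeftAdjoint := ⟨F, h.right_left⟩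

/-- A Frobenius functor is one that belongs to a Frobenius pair. -/
def IsFrobeniusFunctor {𝒞 𝒟 : Type*} [Category 𝒞] [Category 𝒟] (F : 𝒞 ⥤ 𝒟) : Prop :=
  ∃ G : 𝒟 ⥤ 𝒞, IsFrobeniusPair F G

variable {k : Type v} [CommRing k] {A : Type u} [Ring A] [Algebra k A]
  {C : Type u} [AddCommGroup C] [Module A C] [Module Aᵐᵒᵖ C] [SMulCommClass A Aᵐᵒᵖ C] [Coring A C]
  {B : Type u} [Ring B] [Algebra k B]
  {D : Type u} [AddCommGroup D] [Module B D] [Module Bᵐᵒᵖ D] [SMulCommClass B Bᵐᵒᵖ D] [Coring B D]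

/-- The bicomodule `h_D(X, D)` in `^D M^C`, for `X` in `^C M^D` quasi-finite as a right
`D`-comodule: the image of the bicomodule `D` under the functor `h_D(X, -) : M^D → M^C`. -/
noncomputable def cohomBicomod [CentralBimodule k A A C] [CentralBimodule k B B D] [LeftFlat B D]
    (X : Bicomod k A C B D) (hX : QuasiFinite X) : Bicomod k B D A C :=
  induced (cohom X hX) (cohom_isLeftAdjoint X hX) (Bicomod.regular k B D)

end Frobenius

end CoringTheory

/-! The engine is an Eilenberg–Watts theorem for comodules: a `k`-linear left adjoint `F` from right
`C`-comodules to right `D`-comodules that preserves kernels is `- □_C F(C)` (`isoCotensorInduced`).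
Every `Y` is the kernel of `ω : Y ⊗_A C → Y ⊗_A C ⊗_A C`, because `Y □_C C = Y` (`coactHom_exact`).
A left adjoint commutes with tensoring by modules through the isomorphism `Υ`. Hence `F(Y)` is the
kernel of `Y ⊗_A F(C) → Y ⊗_A C ⊗_A F(C)`, that is `Y □_C F(C)`.

Conversely a cotensor functor that is a left adjoint determines its bicomodule, since `C □_C X ≅ X`
compatibly with both coactions (`induced_cotensor_iso`). Naturally isomorphic left adjoints have
isomorphic values at the coring (`induced_iso`), and isomorphic bicomodules have isomorphic cotensor
functors (`cotensorIso`). So conditions on bicomodules and conditions on functors can be exchanged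
as soon as the functors preserve kernels.

Kernel preservation has two sources. A right adjoint preserves kernels
(`PreservesComodKernels.of_isRightAdjoint`); in a Frobenius pair both functors are right adjoints.
The co-hom functor of an injector also preserves them (`cohom_preservesComodKernels`): it is right
exact as a left adjoint, and it preserves monomorphisms because its right adjoint into comodules, `-
⊗_A X`, preserves injectives.

Quasi-finiteness and injectivity are read off from `(Z ⊗_A C) □_C X ≅ Z ⊗_A X`: if `L ⊣ - □_C X`,
then `L` followed by the forgetful functor to modules is left adjoint to `- ⊗_A X`. So `X` is
quasi-finite, and it is an injector when `L` preserves monomorphisms. Flatness enters through the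
kernels: it makes them comodules and makes monomorphisms injective. -/

namespace CoringTheory

/-! ### Functoriality of the balanced tensor product -/

namespace BT

variable {A : Type*} [Ring A] {M M' M'' N N' N'' : Type*}
  [AddCommGroup M] [Module Aᵐᵒᵖ M] [AddCommGroup M'] [Module Aᵐᵒᵖ M']
  [AddCommGroup M''] [Module Aᵐᵒᵖ M'']
  [AddCommGroup N] [Module A N] [AddCommGroup N'] [Module A N'] [AddCommGroup N''] [Module A N'']

/-- `f ⊗ N` of a composite. -/
theorem map_comp_left (g : M' →ₗ[Aᵐᵒᵖ] M'') (f : M →ₗ[Aᵐᵒᵖ] M') (t : BT A M N) :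
    map (g ∘ₗ f) LinearMap.id t = map g (LinearMap.id : N →ₗ[A] N) (map f LinearMap.id t) :=
  (map_map f LinearMap.id g LinearMap.id t).symm

/-- `M ⊗ g` of a composite. -/
theorem map_comp_right (g : N' →ₗ[A] N'') (f : N →ₗ[A] N') (t : BT A M N) :
    map LinearMap.id (g ∘ₗ f) t = map (LinearMap.id : M →ₗ[Aᵐᵒᵖ] M) g (map LinearMap.id f t) :=
  (map_map LinearMap.id f LinearMap.id g t).symm

theorem zero_map (t : BT A M N) :
    map (0 : M →ₗ[Aᵐᵒᵖ] M') (LinearMap.id : N →ₗ[A] N) t = 0 := by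
  have h := map_add_left (0 : M →ₗ[Aᵐᵒᵖ] M') 0 (LinearMap.id : N →ₗ[A] N) t
  rwa [add_zero, left_eq_add] at h

end BT

/-! ### Isomorphisms, monomorphisms and coimages of comodules -/

section Comodules

variable {B : Type u} [Ring B] {D : Type u} [AddCommGroup D] [Module B D] [Module Bᵐᵒᵖ D]
  [SMulCommClass B Bᵐᵒᵖ D] [Coring B D]

/-- A bijective morphism of comodules is an isomorphism. -/
theorem RComod.isIso_of_bijective {M N : RComod B D} (f : M ⟶ N)
    (hf : Function.Bijective f.lin) : IsIso f := by
  let e := LinearEquiv.ofBijective f.lin hf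
  have he : ∀ t : BT B M.carrier D,
      BT.map e.symm.toLinearMap LinearMap.id (BT.map f.lin LinearMap.id t) = t := by
    intro t
    rw [← BT.map_comp_left]
    have : e.symm.toLinearMap ∘ₗ f.lin = LinearMap.id := LinearMap.ext e.symm_apply_apply
    rw [this, BT.map_id]
  let g : N ⟶ M := ⟨e.symm.toLinearMap, fun n => by
    obtain ⟨m, rfl⟩ := hf.2 n
    rw [← f.comm, he]
    exact congrArg M.ρ (e.symm_apply_apply m).symm⟩
  exact ⟨g, by ext m; exact e.symm_apply_apply m, by ext m; exact e.apply_symm_apply m⟩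

/-- The forgetful functor from right comodules to right modules. -/
def forgetComod (B : Type u) [Ring B] (D : Type u) [AddCommGroup D] [Module B D]
    [Module Bᵐᵒᵖ D] [SMulCommClass B Bᵐᵒᵖ D] [Coring B D] : RComod B D ⥤ ModuleCat.{u} Bᵐᵒᵖ where
  obj M := ModuleCat.of _ M.carrier
  map f := ModuleCat.ofHom f.lin

/-- The linear map underlying an isomorphism of comodules is bijective. -/
theorem RComod.bijective_of_isIso {M N : RComod B D} (f : M ⟶ N) [IsIso f] :
    Function.Bijective f.lin :=
  ⟨Function.LeftInverse.injective (g := (inv f).lin)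
      fun m => congrArg (fun e => RComod.Hom.lin e m) (IsIso.hom_inv_id f),
    Function.RightInverse.surjective (g := (inv f).lin)
      fun m => congrArg (fun e => RComod.Hom.lin e m) (IsIso.inv_hom_id f)⟩

theorem mono_of_injective {M N : RComod B D} (f : M ⟶ N) (hf : Function.Injective f.lin) :
    Mono f :=
  ⟨fun _ _ e => RComod.hom_ext fun p => hf (congrArg (fun e => RComod.Hom.lin e p) e)⟩

/-- Over a coring that is flat on the left, monomorphisms of comodules are injective. -/
theorem injective_of_mono [LeftFlat B D] {M N : RComod B D} (f : M ⟶ N) [Mono f] :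
    Function.Injective f.lin := by
  rw [injective_iff_map_eq_zero]
  intro m hm
  -- Flatness makes the kernel a comodule, so the monomorphism can be tested against its inclusion.
  have h : kerι f = 0 := by
    rw [← cancel_mono f, kerι_comp, Limits.zero_comp]
  exact congrArg (fun e => RComod.Hom.lin e (⟨m, hm⟩ : LinearMap.ker f.lin)) h

/-- An injective morphism onto the kernel of `f` identifies its source with that kernel. -/
theorem kerLift_bijective [LeftFlat B D] {M N P : RComod B D} {f : M ⟶ N} (g : P ⟶ M)
    (h : g ≫ f = 0) (hi : Function.Injective g.lin) (he : Function.Exact g.lin f.lin) :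
    Function.Bijective (kerLift g h).lin :=
  ⟨fun p q hpq => hi (congrArg Subtype.val hpq),
    fun m => by
      obtain ⟨p, hp⟩ := (he m.1).1 m.2
      exact ⟨p, Subtype.ext hp⟩⟩

section Quotient

variable [LeftFlat B D] {M N : RComod B D} (f : M ⟶ N)

/-- The coaction of the coimage `M / ker f`. -/
noncomputable def coimρ : (M.carrier ⧸ LinearMap.ker f.lin) →ₗ[Bᵐᵒᵖ]
    BT B (M.carrier ⧸ LinearMap.ker f.lin) D :=
  (LinearMap.ker f.lin).liftQ (BT.rTensor (B := B) D (LinearMap.ker f.lin).mkQ ∘ₗ M.ρ) (by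
    intro m hm
    -- By flatness the coaction of an element of the kernel comes from `ker f ⊗_B D`, which dies in
    -- the tensor product of the quotient with `D`.
    obtain ⟨t, ht⟩ := ker_exists f ⟨m, hm⟩
    rw [LinearMap.mem_ker, LinearMap.comp_apply]
    change BT.map _ _ (M.ρ m) = 0
    rw [← ht]
    change BT.map _ _ (BT.map _ _ t) = 0
    rw [← BT.map_comp_left]
    have : (LinearMap.ker f.lin).mkQ ∘ₗ (LinearMap.ker f.lin).subtype = 0 := by
      ext x
      exact (Submodule.Quotient.mk_eq_zero _).2 x.2
    rw [this, BT.zero_map])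

/-- The coimage `M / ker f` of a morphism of comodules. -/
noncomputable abbrev coimComod : RComod B D where
  carrier := M.carrier ⧸ LinearMap.ker f.lin
  ρ := coimρ f
  coassoc q := by
    obtain ⟨m, rfl⟩ := (LinearMap.ker f.lin).mkQ_surjective q
    have e : coimρ f ∘ₗ (LinearMap.ker f.lin).mkQ =
      BT.rTensor (B := B) D (LinearMap.ker f.lin).mkQ ∘ₗ M.ρ := rfl
    change BT.assoc _ _ _ (BT.map (coimρ f) LinearMap.id
      (BT.map (LinearMap.ker f.lin).mkQ LinearMap.id (M.ρ m))) =
      BT.map LinearMap.id _ (BT.map (LinearMap.ker f.lin).mkQ LinearMap.id (M.ρ m))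
    rw [← BT.map_comp_left, e, BT.map_comp_left, BT.assoc_rTensor, M.coassoc, BT.map_comm]
  counit q := by
    obtain ⟨m, rfl⟩ := (LinearMap.ker f.lin).mkQ_surjective q
    change BT.rid (BT.map LinearMap.id _
      (BT.map (LinearMap.ker f.lin).mkQ LinearMap.id (M.ρ m))) = _
    rw [BT.map_comm, BT.rid_map, M.counit]

/-- The projection onto the coimage. -/
noncomputable def coimπ : M ⟶ coimComod f where
  lin := (LinearMap.ker f.lin).mkQ
  comm _ := rfl

theorem coimπ_surjective : Function.Surjective (coimπ f).lin :=
  (LinearMap.ker f.lin).mkQ_surjective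

variable {f}

/-- A morphism that vanishes on the kernel of `f` factors through the coimage of `f`. -/
noncomputable def coimDesc {P : RComod B D} (g : M ⟶ P) (h : kerι f ≫ g = 0) :
    coimComod f ⟶ P where
  lin := (LinearMap.ker f.lin).liftQ g.lin
    (fun m hm => LinearMap.mem_ker.2
      (congrArg (fun e => RComod.Hom.lin e (⟨m, hm⟩ : LinearMap.ker f.lin)) h))
  comm q := by
    obtain ⟨m, rfl⟩ := coimπ_surjective f q
    rw [← (coimπ f).comm, ← BT.map_comp_left]
    exact g.comm m

variable (f)

/-- The inclusion of the coimage of `f` into the target. -/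
noncomputable def coimι : coimComod f ⟶ N :=
  coimDesc f (kerι_comp f)

theorem coimι_injective : Function.Injective (coimι f).lin := by
  rw [injective_iff_map_eq_zero]
  intro q hq
  obtain ⟨m, rfl⟩ := coimπ_surjective f q
  exact (Submodule.Quotient.mk_eq_zero _).2 hq

end Quotient

end Comodules

/-! ### Functors that preserve kernels -/

section Kernels

variable {A : Type u} [Ring A] {C : Type u} [AddCommGroup C] [Module A C] [Module Aᵐᵒᵖ C]
  [SMulCommClass A Aᵐᵒᵖ C] [Coring A C]
  {B : Type u} [Ring B] {D : Type u} [AddCommGroup D] [Module B D] [Module Bᵐᵒᵖ D]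
  [SMulCommClass B Bᵐᵒᵖ D] [Coring B D]

/-- `F` sends kernels of comodule morphisms to kernels, on the level of underlying groups. -/
structure PreservesComodKernels [LeftFlat A C] (F : RComod A C ⥤ RComod B D) : Prop where
  injective : ∀ {M N : RComod A C} (f : M ⟶ N), Function.Injective (F.map (kerι f)).lin
  exact : ∀ {M N : RComod A C} (f : M ⟶ N),
    Function.Exact (F.map (kerι f)).lin (F.map f).lin

/-- A right adjoint functor preserves kernels. -/
theorem PreservesComodKernels.of_isRightAdjoint [LeftFlat A C] [LeftFlat B D]
    (F : RComod A C ⥤ RComod B D) [F.Additive] (hF : F.IsRightAdjoint) :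
    PreservesComodKernels F where
  injective f := by
    have := mono_of_injective (kerι f) (kerι_injective f)
    exact injective_of_mono _
  exact {M N} f := by
    obtain ⟨G, ⟨adj⟩⟩ := hF
    intro x
    constructor
    · intro hx
      -- The transpose of the inclusion of `ker F(f)` is killed by `f`, hence factors through `ker
      -- f`; transposing that factorization back lifts the inclusion along `F(ker f) → F(M)`.
      let g := (adj.homEquiv _ _).symm (kerι (F.map f))
      have hg : g ≫ f = 0 := by
        apply (adj.homEquiv _ _).injective
        rw [adj.homEquiv_naturality_right, Equiv.apply_symm_apply, kerι_comp,
          adj.homEquiv_unit, F.map_zero, Limits.comp_zero]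
      have h : adj.homEquiv _ _ (kerLift g hg) ≫ F.map (kerι f) = kerι (F.map f) := by
        rw [← adj.homEquiv_naturality_right, kerLift_ι, Equiv.apply_symm_apply]
      exact ⟨_, congrArg
        (fun e => RComod.Hom.lin e (⟨x, hx⟩ : LinearMap.ker (F.map f).lin)) h⟩
    · rintro ⟨y, rfl⟩
      have h : F.map (kerι f) ≫ F.map f = 0 := by rw [← F.map_comp, kerι_comp, F.map_zero]
      exact congrArg (fun e => RComod.Hom.lin e y) h

end Kernels

/-! ### The cotensor product as a functor of both arguments -/

section Cotensor

variable {k : Type v} [CommRing k] {A : Type u} [Ring A] [Algebra k A]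
  {C : Type u} [AddCommGroup C] [Module A C] [Module Aᵐᵒᵖ C] [SMulCommClass A Aᵐᵒᵖ C] [Coring A C]
  {B : Type u} [Ring B] [Algebra k B]
  {D : Type u} [AddCommGroup D] [Module B D] [Module Bᵐᵒᵖ D] [SMulCommClass B Bᵐᵒᵖ D] [Coring B D]

theorem cotensorω_apply (Y : RComod A C) (X : Bicomod k A C B D) (t : BT A Y.carrier X.carrier) :
    (cotensorω Y X).lin t = BT.map Y.ρ LinearMap.id t - tensorLamLin Y.carrier X t := by
  unfold cotensorω
  rw [RComod.sub_lin]
  rfl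

/-- The equalizer form of membership in `Y □_C X`, in which coassociativity can be applied directly.
-/
theorem cotensorω_apply_eq_zero {Y : RComod A C} {X : Bicomod k A C B D}
    {t : BT A Y.carrier X.carrier} :
    (cotensorω Y X).lin t = 0 ↔ BT.map Y.ρ LinearMap.id t = tensorLamLin Y.carrier X t := by
  rw [cotensorω_apply, sub_eq_zero]

section Instances

variable [LeftFlat B D] (X : Bicomod k A C B D)

instance : (cotensor X).Additive where
  map_add {Y Y' f g} := by
    apply ker_hom_ext
    ext t
    exact BT.map_add_left f.lin g.lin LinearMap.id _

/-- A scalar acting on `Y'` crosses the tensor sign to the left action on `X`, and centrality of `X`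
turns it into the right `B`-action. -/
instance [CentralBimodule k A A C] [CentralBimodule k B B D] : (cotensor X).Linear k where
  map_smul {Y Y'} f r := by
    apply ker_hom_ext
    ext t
    change BT.map (RComod.scalar k r ∘ₗ f.lin) LinearMap.id t.1 =
      op (algebraMap k B r) • BT.map f.lin LinearMap.id t.1
    generalize t.1 = s
    induction s using BT.induction_on with
    | h0 => simp
    | ht y x =>
      rw [BT.map_tmul, BT.map_tmul, BT.smul_tmul_right]
      refine (BT.smul_tmul _ _ _).trans ?_
      exact congrArg _ (CentralBimodule.central (A := A) (B := B) r x)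
    | ha s t hs ht => rw [map_add, map_add, smul_add, hs, ht]

end Instances

section Bicomodule

variable {X X' : Bicomod k A C B D}

/-- `Z ⊗_A f` as a morphism of right comodules, for a morphism of bicomodules `f`. -/
def tensorComodRight (Z : Type u) [AddCommGroup Z] [Module Aᵐᵒᵖ Z] (f : X ⟶ X') :
    tensorComod Z X.toModComod ⟶ tensorComod Z X'.toModComod :=
  tensorDesc X.toModComod
    (fun z => (⟨relin f.lin f.lin_op, f.comm_rho⟩ : RComod.Hom X.toRComod X'.toRComod) ≫
      tmulHom X'.toModComod z)
    (fun z z' => by rw [tmulHom_add]; exact Preadditive.comp_add _ _ _ _ _ _)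
    (fun r z => by
      ext x
      refine (BT.smul_tmul r z (f.lin x)).trans ?_
      exact congrArg (BT.tmul A z) (map_smul f.lin r x).symm)

theorem tensorComodRight_apply (Z : Type u) [AddCommGroup Z] [Module Aᵐᵒᵖ Z] (f : X ⟶ X')
    (t : BT A Z X.carrier) : (tensorComodRight Z f).lin t = BT.map LinearMap.id f.lin t := by
  induction t using BT.induction_on with
  | h0 => simp
  | ht z x => rfl
  | ha s t hs ht => rw [map_add, map_add, hs, ht]

/-- This is compatibility of `f` with the left coactions, tensored with `Z`; it is what lets `Y ⊗_A
f` restrict to cotensor products. -/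
theorem tensorLamLin_tensorComodRight (Z : Type u) [AddCommGroup Z] [Module Aᵐᵒᵖ Z]
    (f : X ⟶ X') (t : BT A Z X.carrier) :
    tensorLamLin Z X' (BT.map LinearMap.id f.lin t) =
      BT.map LinearMap.id f.lin (tensorLamLin Z X t) := by
  induction t using BT.induction_on with
  | h0 => simp
  | ht z x =>
    rw [BT.map_tmul, tensorLamLin_tmul, tensorLamLin_tmul, BT.map_comm, f.comm_lam]
    rfl
  | ha s t hs ht => simp only [map_add, hs, ht]

variable [LeftFlat B D]

/-- The natural transformation `- □_C X → - □_C X'` given by a morphism of bicomodules. -/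
noncomputable def cotensorMap (f : X ⟶ X') : cotensor X ⟶ cotensor X' where
  app Y := kerLift (kerι (cotensorω Y X) ≫ tensorComodRight Y.carrier f) (by
    ext t
    change (cotensorω Y X').lin ((tensorComodRight Y.carrier f).lin t.1) = 0
    rw [tensorComodRight_apply, cotensorω_apply_eq_zero, tensorLamLin_tensorComodRight,
      ← BT.map_comm, cotensorω_apply_eq_zero.1 t.2])
  naturality Y Y' g := by
    apply ker_hom_ext
    ext t
    change (tensorComodRight Y'.carrier f).lin (BT.map g.lin LinearMap.id t.1) =
      BT.map g.lin LinearMap.id ((tensorComodRight Y.carrier f).lin t.1)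
    rw [tensorComodRight_apply, tensorComodRight_apply, BT.map_comm]

/-- Isomorphic bicomodules have isomorphic cotensor product functors. -/
noncomputable def cotensorIso (e : X ≅ X') : cotensor X ≅ cotensor X' where
  hom := cotensorMap e.hom
  inv := cotensorMap e.inv
  hom_inv_id := by
    ext Y t
    apply Subtype.ext
    change (tensorComodRight Y.carrier e.inv).lin ((tensorComodRight Y.carrier e.hom).lin t.1) =
      t.1
    rw [tensorComodRight_apply, tensorComodRight_apply, ← BT.map_comp_right]
    have h : e.inv.lin ∘ₗ e.hom.lin = LinearMap.id :=
      congrArg Bicomod.Hom.lin e.hom_inv_id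
    rw [h, BT.map_id]
  inv_hom_id := by
    ext Y t
    apply Subtype.ext
    change (tensorComodRight Y.carrier e.hom).lin ((tensorComodRight Y.carrier e.inv).lin t.1) =
      t.1
    rw [tensorComodRight_apply, tensorComodRight_apply, ← BT.map_comp_right]
    have h : e.hom.lin ∘ₗ e.inv.lin = LinearMap.id :=
      congrArg Bicomod.Hom.lin e.inv_hom_id
    rw [h, BT.map_id]

end Bicomodule

/-- A bijective morphism of bicomodules is an isomorphism. -/
theorem Bicomod.isIso_of_bijective {X X' : Bicomod k A C B D} (f : X ⟶ X')
    (hf : Function.Bijective f.lin) : IsIso f := by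
  let e := LinearEquiv.ofBijective f.lin hf
  have h1 : e.symm.toLinearMap ∘ₗ f.lin = LinearMap.id := LinearMap.ext e.symm_apply_apply
  have hop : ∀ (b : Bᵐᵒᵖ) (x : X'.carrier),
      e.symm.toLinearMap (b • x) = b • e.symm.toLinearMap x := by
    intro b x
    obtain ⟨x, rfl⟩ := hf.2 x
    rw [← f.lin_op]
    exact (e.symm_apply_apply _).trans (congrArg (b • ·) (e.symm_apply_apply x).symm)
  let g : X' ⟶ X :=
    { lin := e.symm.toLinearMap
      lin_op := hop
      comm_lam := fun x => by
        obtain ⟨x, rfl⟩ := hf.2 x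
        rw [← f.comm_lam, ← BT.map_comp_right, h1, BT.map_id]
        exact congrArg X.lam (e.symm_apply_apply x).symm
      comm_rho := fun x => by
        obtain ⟨x, rfl⟩ := hf.2 x
        have h2 : relin e.symm.toLinearMap hop ∘ₗ relin f.lin f.lin_op = LinearMap.id :=
          LinearMap.ext e.symm_apply_apply
        rw [← f.comm_rho, ← BT.map_comp_left, h2, BT.map_id]
        exact congrArg X.rho (e.symm_apply_apply x).symm }
  exact ⟨g, Bicomod.Hom.ext h1, Bicomod.Hom.ext (LinearMap.ext e.apply_symm_apply)⟩

section TensorCoring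

variable (X : Bicomod k A C B D) (Z : Type u) [AddCommGroup Z] [Module Aᵐᵒᵖ Z]

/-- The left counit law tensored with `Z`: here `ε` is applied to the first of the two copies of
`C`. -/
theorem counitLin_comulLin (t : BT A Z C) :
    BT.map (counitLin C Z) LinearMap.id (comulLin C Z t) = t := by
  induction t using BT.induction_on with
  | h0 => simp
  | ht z c =>
    have h : ∀ s : BT A C C,
        BT.map (counitLin C Z ∘ₗ BT.tmulRight z) LinearMap.id s =
          BT.tmul A z (BT.lid (BT.map (relin Coring.ε Coring.ε_op) LinearMap.id s)) := by
      intro s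
      induction s using BT.induction_on with
      | h0 => simpa using (map_zero (BT.mk A Z C z)).symm
      | ht c x => exact BT.smul_tmul _ _ _
      | ha s t hs ht => simp only [map_add, hs, ht, BT.tmul_add]
    refine (BT.map_comp_left _ _ _).symm.trans ((h _).trans ?_)
    exact congrArg (BT.tmul A z) (Coring.counit_left c)
  | ha s t hs ht => simp only [map_add, hs, ht]

/-- The counit `Z ⊗_A ε ⊗_A X` is a retraction. -/
theorem tensorLamLin_injective : Function.Injective (tensorLamLin Z X) :=
  Function.LeftInverse.injective (map_counitLin Z X)

variable {Z} in
/-- The coaction `Z ⊗_A X → Z ⊗_A C ⊗_A X` identifies `Z ⊗_A X` with `(Z ⊗_A C) □_C X`. -/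
theorem exists_tensorLamLin {t : BT A (BT A Z C) X.carrier}
    (ht : BT.map (comulLin C Z) LinearMap.id t = tensorLamLin (BT A Z C) X t) :
    ∃ s, tensorLamLin Z X s = t := by
  -- The preimage is obtained by applying `ε` to the copy of `C`. Its coaction is `ε` applied to the
  -- first copy of `C` in `(Z ⊗_A C ⊗_A λ)(t)`; by `ht` this may be computed on `(Z ⊗_A Δ ⊗_A
  -- X)(t)`, where the left counit law gives back `t`.
  refine ⟨BT.map (counitLin C Z) LinearMap.id t, ?_⟩
  rw [tensorLamLin_map, ← ht, ← BT.map_comp_left]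
  have h : BT.rTensor C (counitLin C Z) ∘ₗ comulLin C Z = LinearMap.id :=
    LinearMap.ext (counitLin_comulLin (A := A) (C := C) Z)
  rw [h, BT.map_id]

end TensorCoring

end Cotensor

/-! ### Dependence of the bicomodule `F(M)` on the functor `F` -/

section InducedIso

variable {k : Type v} [CommRing k] {R : Type u} [Ring R] [Algebra k R]
  {A : Type u} [Ring A] [Algebra k A]
  {C : Type u} [AddCommGroup C] [Module A C] [Module Aᵐᵒᵖ C] [SMulCommClass A Aᵐᵒᵖ C] [Coring A C]
  {B : Type u} [Ring B] [Algebra k B]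
  {D : Type u} [AddCommGroup D] [Module B D] [Module Bᵐᵒᵖ D] [SMulCommClass B Bᵐᵒᵖ D] [Coring B D]
  [CentralBimodule k A A C] [CentralBimodule k B B D]
  {F F' : RComod A C ⥤ RComod B D} [F.Additive] [F.Linear k] [F'.Additive] [F'.Linear k]

/-- `Y ⊗_R α_M : Y ⊗_R F(M) → Y ⊗_R F'(M)` for a natural transformation `α : F → F'`. -/
def tensorTrans (α : F ⟶ F') (Y : Type u) [AddCommGroup Y] [Module Rᵐᵒᵖ Y]
    (M : ModComod k R A C) :
    tensorComod Y (inducedModComod F M) ⟶ tensorComod Y (inducedModComod F' M) :=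
  tensorDesc (inducedModComod F M)
    (fun y => α.app M.toRComod ≫ tmulHom (inducedModComod F' M) y)
    (fun y y' => by rw [tmulHom_add]; exact Preadditive.comp_add _ _ _ _ _ _)
    (fun r y => by
      rw [tmulHom_smul, actHom_induced, actHom_induced, ← Category.assoc, ← α.naturality,
        Category.assoc])

/-- Naturality of `Υ` in the functor. On each `y ⊗ -` it reduces to naturality of `α` at the
morphism `y ⊗ - : M → Y ⊗_R M`. -/
theorem tensorTrans_upsilon (α : F ⟶ F') (Y : Type u) [AddCommGroup Y] [Module Rᵐᵒᵖ Y]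
    (M : ModComod k R A C) :
    tensorTrans α Y M ≫ upsilon F' Y M = upsilon F Y M ≫ α.app (tensorComod Y M) := by
  apply tensor_hom_ext
  intro y
  have h : tmulHom (inducedModComod F M) y ≫ tensorTrans α Y M =
    α.app M.toRComod ≫ tmulHom (inducedModComod F' M) y := rfl
  rw [← Category.assoc, h, Category.assoc, tmulHom_upsilon, ← Category.assoc, tmulHom_upsilon,
    α.naturality]

variable {E : Type u} [AddCommGroup E] [Module R E] [Module Rᵐᵒᵖ E] [SMulCommClass R Rᵐᵒᵖ E]
  [Coring R E]

/-- The left coactions involve `Υ⁻¹`, so the comparison is made after composing with `Υ`, where it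
becomes naturality of `α` at `λ_M`. -/
theorem inducedLam_natTrans (hF : F.IsLeftAdjoint) (hF' : F'.IsLeftAdjoint) (α : F ⟶ F')
    (M : Bicomod k R E A C) :
    α.app M.toRComod ≫ inducedLam F' hF' M =
      inducedLam F hF M ≫ tensorTrans α E M.toModComod := by
  apply upsilon_cancel F' hF'
  rw [Category.assoc, inducedLam_upsilon, Category.assoc, tensorTrans_upsilon, ← Category.assoc,
    inducedLam_upsilon, α.naturality]

/-- The morphism of bicomodules `F(M) → F'(M)` given by a natural transformation `F → F'`. -/
noncomputable def inducedMap (hF : F.IsLeftAdjoint) (hF' : F'.IsLeftAdjoint) (α : F ⟶ F')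
    (M : Bicomod k R E A C) : induced F hF M ⟶ induced F' hF' M where
  lin :=
    { toFun := (α.app M.toRComod).lin
      map_add' := map_add _
      map_smul' := fun r x => congrArg (fun e => RComod.Hom.lin e x)
        (α.naturality (actHom M.toModComod r)) }
  lin_op b x := map_smul (α.app M.toRComod).lin b x
  comm_lam x := by
    refine Eq.trans ?_
      (congrArg (fun e => RComod.Hom.lin e x) (inducedLam_natTrans hF hF' α M)).symm
    change _ = (tensorTrans α E M.toModComod).lin ((inducedLam F hF M).lin x)
    change BT.map LinearMap.id _ ((inducedLam F hF M).lin x) = _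
    generalize (inducedLam F hF M).lin x = t
    induction t using BT.induction_on with
    | h0 => exact (map_zero _).trans (map_zero _).symm
    | ht e m => rfl
    | ha s t hs ht =>
      exact (map_add _ _ _).trans ((congrArg₂ _ hs ht).trans (map_add _ _ _).symm)
  comm_rho x := (α.app M.toRComod).comm x

/-- Isomorphic functors induce isomorphic bicomodules. -/
theorem induced_iso (hF : F.IsLeftAdjoint) (hF' : F'.IsLeftAdjoint) (α : F ≅ F')
    (M : Bicomod k R E A C) : Nonempty (induced F hF M ≅ induced F' hF' M) := by
  have := Bicomod.isIso_of_bijective (inducedMap hF hF' α.hom M)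
    (RComod.bijective_of_isIso (α.hom.app M.toRComod))
  exact ⟨asIso (inducedMap hF hF' α.hom M)⟩

end InducedIso

/-! ### The isomorphism of bicomodules `C □_C X ≅ X` -/

section Regular

variable {k : Type v} [CommRing k] {A : Type u} [Ring A] [Algebra k A]
  {C : Type u} [AddCommGroup C] [Module A C] [Module Aᵐᵒᵖ C] [SMulCommClass A Aᵐᵒᵖ C] [Coring A C]
  {B : Type u} [Ring B] [Algebra k B]
  {D : Type u} [AddCommGroup D] [Module B D] [Module Bᵐᵒᵖ D] [SMulCommClass B Bᵐᵒᵖ D] [Coring B D]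
  [CentralBimodule k A A C]

section Unit

variable (X : Bicomod k A C B D)

theorem lamHom_cotensorω : lamHom X ≫ cotensorω (Bicomod.regular k A C).toRComod X = 0 := by
  ext x
  change (cotensorω (Bicomod.regular k A C).toRComod X).lin (X.lam x) = 0
  rw [cotensorω_apply_eq_zero]
  apply (BT.assoc C C X.carrier).injective
  exact (X.lam_coassoc x).trans ((BT.assoc C C X.carrier).apply_symm_apply _).symm

variable [LeftFlat B D]

/-- The left coaction of `X` as a morphism `X → C □_C X` of right comodules. -/
noncomputable def lamCotensor :
    X.toRComod ⟶ (cotensor X).obj (Bicomod.regular k A C).toRComod :=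
  kerLift (lamHom X) (lamHom_cotensorω X)

/-- The inverse is `ε ⊗_A X` restricted to `C □_C X`: one composite is the counit law of `X`, the
other combines the cotensor equation with the left counit law of `C`. -/
theorem lamCotensor_bijective : Function.Bijective (lamCotensor X).lin := by
  constructor
  · intro x y h
    have h' : X.lam x = X.lam y := congrArg Subtype.val h
    rw [← X.lam_counit x, h', X.lam_counit]
  · intro t
    have ht : BT.map (relin Coring.Δ Coring.Δ_op) LinearMap.id t.1 = tensorLamLin C X t.1 :=
      cotensorω_apply_eq_zero.1 t.2
    let r : BT A C X.carrier →+ X.carrier :=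
      BT.lid.comp (BT.map (relin Coring.ε Coring.ε_op) LinearMap.id)
    refine ⟨r t.1, Subtype.ext ?_⟩
    change X.lam (r t.1) = t.1
    -- Since `λ` is left `A`-linear, `λ ∘ (ε ⊗ X)` equals `(ε ⊗ C ⊗ X) ∘ (C ⊗ λ)`.
    have h1 : ∀ s : BT A C X.carrier, X.lam (r s) =
        BT.lid (BT.map (relin Coring.ε Coring.ε_op) LinearMap.id
          (BT.assoc C C X.carrier (tensorLamLin C X s))) := by
      intro s
      have e : BT.assoc C C X.carrier (tensorLamLin C X s) = BT.map LinearMap.id X.lam s :=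
        (BT.assoc C C X.carrier).apply_symm_apply _
      rw [e]
      induction s using BT.induction_on with
      | h0 => simp
      | ht c x => exact map_smul X.lam _ _
      | ha s t hs ht =>
        have := fun s => (BT.assoc C C X.carrier).apply_symm_apply
          (BT.map LinearMap.id X.lam s)
        rw [map_add, map_add, hs (this _), ht (this _), map_add, map_add, map_add]
    -- The left counit law of `C`, tensored with `X`.
    have h2 : ∀ s : BT A C X.carrier, BT.lid (BT.map (relin Coring.ε Coring.ε_op) LinearMap.id
        (BT.assoc C C X.carrier (BT.map (relin Coring.Δ Coring.Δ_op) LinearMap.id s))) = s := by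
      intro s
      induction s using BT.induction_on with
      | h0 => simp
      | ht c x =>
        have h3 : ∀ q : BT A C C, BT.lid (BT.map (relin Coring.ε Coring.ε_op) LinearMap.id
            (BT.assoc C C X.carrier (BT.tmul A q x))) =
            BT.tmul A (BT.lid (BT.map (relin Coring.ε Coring.ε_op) LinearMap.id q)) x := by
          intro q
          induction q using BT.induction_on with
          | h0 =>
            have h0 : ∀ {Z : Type u} [AddCommGroup Z] [Module Aᵐᵒᵖ Z],
              BT.tmul A (0 : Z) x = 0 := fun {Z} _ _ => map_zero ((BT.mk A Z X.carrier).flip x)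
            simp [h0]
          | ht c c' => rfl
          | ha s t hs ht => simp only [BT.add_tmul, map_add, hs, ht]
        refine (h3 _).trans ?_
        exact congrArg (fun c => BT.tmul A c x) (Coring.counit_left c)
      | ha s t hs ht => simp only [map_add, hs, ht]
    rw [h1, ← ht, h2]

theorem lamCotensor_act (a : A) :
    actHom X.toModComod a ≫ lamCotensor X =
      lamCotensor X ≫ (cotensor X).map (actHom (Bicomod.regular k A C).toModComod a) := by
  apply ker_hom_ext
  ext x
  exact map_smul X.lam a x

variable [CentralBimodule k B B D]

/-- `Y ⊗_A X → Y ⊗_A (C □_C X)` as a morphism of right comodules. -/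
noncomputable def tensorLamCotensor (Y : Type u) [AddCommGroup Y] [Module Aᵐᵒᵖ Y] :
    tensorComod Y X.toModComod ⟶
      tensorComod Y (inducedModComod (cotensor X) (Bicomod.regular k A C).toModComod) :=
  tensorDesc X.toModComod
    (fun y => lamCotensor X ≫
      tmulHom (inducedModComod (cotensor X) (Bicomod.regular k A C).toModComod) y)
    (fun y y' => by rw [tmulHom_add]; exact Preadditive.comp_add _ _ _ _ _ _)
    (fun r y => by
      rw [tmulHom_smul, actHom_induced, ← Category.assoc, ← Category.assoc, lamCotensor_act])

/-- For a cotensor functor, `Υ` becomes explicit once the target `(Y ⊗_A C) □_C X` is embedded in `Y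
⊗_A C ⊗_A X`. -/
theorem tensorLamCotensor_upsilon (Y : Type u) [AddCommGroup Y] [Module Aᵐᵒᵖ Y] :
    tensorLamCotensor X Y ≫ upsilon (cotensor X) Y (Bicomod.regular k A C).toModComod ≫ kerι _ =
      tensorLam Y X := by
  apply tensor_hom_ext
  intro y
  rfl

variable (hX : (cotensor X).IsLeftAdjoint)

/-- After composing with `Υ` and the inclusion of the kernel, both sides are iterated coactions of
`X`, so the identity is coassociativity of `λ_X`. -/
theorem lamCotensor_inducedLam :
    lamCotensor X ≫ inducedLam (cotensor X) hX (Bicomod.regular k A C) =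
      lamHom X ≫ tensorLamCotensor X C := by
  apply upsilon_cancel (cotensor X) hX
  rw [Category.assoc, inducedLam_upsilon, Category.assoc]
  apply ker_hom_ext
  ext x
  change BT.map (relin Coring.Δ Coring.Δ_op) LinearMap.id (X.lam x) =
    (tensorLamCotensor X C ≫ upsilon (cotensor X) C (Bicomod.regular k A C).toModComod ≫
      kerι _).lin (X.lam x)
  rw [tensorLamCotensor_upsilon]
  apply (BT.assoc C C X.carrier).injective
  exact (X.lam_coassoc x).trans ((BT.assoc C C X.carrier).apply_symm_apply _).symm

/-- The left coaction of `X` as a morphism of bicomodules from `X` to `C □_C X`. -/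
noncomputable def toInducedCotensor :
    X ⟶ induced (cotensor X) hX (Bicomod.regular k A C) where
  lin :=
    { toFun := (lamCotensor X).lin
      map_add' := map_add _
      map_smul' := fun r x => congrArg (fun e => RComod.Hom.lin e x) (lamCotensor_act X r) }
  lin_op b x := map_smul (lamCotensor X).lin b x
  comm_lam x := by
    refine Eq.trans ?_
      (congrArg (fun e => RComod.Hom.lin e x) (lamCotensor_inducedLam X hX)).symm
    change _ = (tensorLamCotensor X C).lin (X.lam x)
    generalize X.lam x = t
    induction t using BT.induction_on with
    | h0 => exact (map_zero _).trans (map_zero _).symm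
    | ht e m => rfl
    | ha s t hs ht =>
      exact (map_add _ _ _).trans ((congrArg₂ _ hs ht).trans (map_add _ _ _).symm)
  comm_rho x := (lamCotensor X).comm x

/-- `C □_C X ≅ X` as bicomodules. -/
theorem induced_cotensor_iso :
    Nonempty (induced (cotensor X) hX (Bicomod.regular k A C) ≅ X) := by
  have := Bicomod.isIso_of_bijective (toInducedCotensor X hX) (lamCotensor_bijective X)
  exact ⟨(asIso (toInducedCotensor X hX)).symm⟩

end Unit

end Regular

/-! ### Cofree comodules and the resolution of `Y` by `Y ⊗_A C` -/

section Cofree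

variable {A : Type u} [Ring A]
  {C : Type u} [AddCommGroup C] [Module A C] [Module Aᵐᵒᵖ C] [SMulCommClass A Aᵐᵒᵖ C] [Coring A C]
  (Z : Type u) [AddCommGroup Z] [Module Aᵐᵒᵖ Z]

variable {Z} in
theorem counitLin_map {Z' : Type u} [AddCommGroup Z'] [Module Aᵐᵒᵖ Z'] (f : Z →ₗ[Aᵐᵒᵖ] Z')
    (t : BT A Z C) : counitLin C Z' (BT.map f LinearMap.id t) = f (counitLin C Z t) := by
  change BT.rid (BT.map LinearMap.id _ (BT.map f LinearMap.id t)) = _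
  rw [BT.map_comm, BT.rid_map]
  rfl

/-- The right counit law tensored with `Z`: here `ε` is applied to the last copy of `C`. -/
theorem counitLin_tensor_comulLin (t : BT A Z C) :
    counitLin C (BT A Z C) (comulLin C Z t) = t := by
  induction t using BT.induction_on with
  | h0 => simp
  | ht z c =>
    have h : comulLin C Z (BT.tmul A z c) =
      BT.map (BT.tmulRight (A := A) z) LinearMap.id (Coring.Δ c) := rfl
    rw [h, counitLin_map]
    exact congrArg (BT.tmul A z) (Coring.counit_right c)
  | ha s t hs ht => simp only [map_add, hs, ht]

variable {k : Type v} [CommRing k] [Algebra k A] [CentralBimodule k A A C]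

variable (k) in
/-- The coaction of `Y` as a morphism `Y → Y ⊗_A C` of right comodules. -/
def coactHom (Y : RComod A C) :
    Y ⟶ tensorComod Y.carrier (Bicomod.regular k A C).toModComod where
  lin := Y.ρ
  comm m := by
    apply (BT.assoc Y.carrier C C).injective
    exact (Y.coassoc m).trans ((BT.assoc Y.carrier C C).apply_symm_apply _).symm

theorem coactHom_naturality {Y Y' : RComod A C} (g : Y ⟶ Y') :
    g ≫ coactHom k Y' = coactHom k Y ≫ tensorComodMap _ g.lin := by
  ext m
  exact (g.comm m).symm

variable (k) in
theorem coactHom_cotensorω (Y : RComod A C) :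
    coactHom k Y ≫ cotensorω Y (Bicomod.regular k A C) = 0 := by
  ext m
  change (cotensorω Y (Bicomod.regular k A C)).lin (Y.ρ m) = 0
  rw [cotensorω_apply_eq_zero]
  exact (coactHom k Y).comm m

variable (k) in
theorem coactHom_injective (Y : RComod A C) : Function.Injective (coactHom k Y).lin := by
  intro x y h
  have h' : Y.ρ x = Y.ρ y := h
  rw [← Y.counit x, h', Y.counit]

variable (k) in
-- Together with injectivity of the coaction this says `Y ≅ Y □_C C`. An element `t` of the kernel
-- is the coaction of `(Y ⊗ ε)(t)`, by the equation defining the kernel and the right counit law.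
theorem coactHom_exact (Y : RComod A C) :
    Function.Exact (coactHom k Y).lin (cotensorω Y (Bicomod.regular k A C)).lin := by
  intro t
  constructor
  · intro ht
    refine ⟨counitLin C _ t, ?_⟩
    have h : BT.map Y.ρ LinearMap.id t = comulLin C Y.carrier t :=
      cotensorω_apply_eq_zero.1 ht
    change Y.ρ _ = t
    rw [← counitLin_map, h, counitLin_tensor_comulLin]
  · rintro ⟨y, rfl⟩
    exact congrArg (fun e => RComod.Hom.lin e y) (coactHom_cotensorω k Y)

variable (k A C) in
/-- The forgetful functor `M^C → M_A` is left adjoint to `- ⊗_A C`. -/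
def forgetAdj : forgetComod A C ⊣ tensorFunctor (Bicomod.regular k A C).toModComod :=
  Adjunction.mkOfHomEquiv
    { homEquiv := fun M Z =>
        -- The unit is the coaction `ρ_M` and the counit is `Z ⊗ ε`. One round trip is the counit
        -- law of `M`; the other uses that `h` is a comodule morphism, then the left counit law of
        -- `C`.
        { toFun := fun f => coactHom k M ≫ tensorComodMap _ f.hom
          invFun := fun h => ModuleCat.ofHom (counitLin C Z ∘ₗ h.lin)
          left_inv := fun f => by
            ext m
            exact (counitLin_map (Z := M.carrier) (Z' := Z) f.hom (M.ρ m)).trans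
              (congrArg f.hom (M.counit m))
          right_inv := fun h => by
            ext m
            let l : M.carrier →ₗ[Aᵐᵒᵖ] BT A Z C := h.lin
            refine (BT.map_comp_left (counitLin C Z) l (M.ρ m)).trans ?_
            refine (congrArg (BT.map (counitLin C Z) LinearMap.id) (h.comm m)).trans ?_
            exact counitLin_comulLin (C := C) Z (h.lin m) }
      homEquiv_naturality_left_symm := fun _ _ => rfl
      homEquiv_naturality_right := fun {M Z Z'} f g => by
        ext m
        exact BT.map_comp_left _ _ _ }

/-- Flatness is what makes a categorical monomorphism of comodules injective. -/
instance [LeftFlat A C] : (forgetComod A C).PreservesMonomorphisms where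
  preserves f _ := (ModuleCat.mono_iff_injective _).2 (injective_of_mono f)

/-- Preservation is stated for the chosen kernels only; this transports it to `Y`, which is a kernel
of `ω` by way of its coaction. -/
theorem PreservesComodKernels.map_coact [LeftFlat A C] {B : Type u} [Ring B]
    {D : Type u} [AddCommGroup D] [Module B D] [Module Bᵐᵒᵖ D] [SMulCommClass B Bᵐᵒᵖ D]
    [Coring B D] {F : RComod A C ⥤ RComod B D}
    (hK : PreservesComodKernels F) (Y : RComod A C) :
    Function.Injective (F.map (coactHom k Y)).lin ∧ Function.Exact (F.map (coactHom k Y)).lin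
      (F.map (cotensorω Y (Bicomod.regular k A C))).lin := by
  let e := kerLift (coactHom k Y) (coactHom_cotensorω k Y)
  have : IsIso e := RComod.isIso_of_bijective _
    (kerLift_bijective _ _ (coactHom_injective k Y) (coactHom_exact k Y))
  have he : (F.map (coactHom k Y)).lin =
      (F.map (kerι (cotensorω Y (Bicomod.regular k A C)))).lin ∘ₗ (F.map e).lin := by
    rw [← RComod.comp_lin, ← F.map_comp]
    rfl
  have hb := RComod.bijective_of_isIso (F.map e)
  rw [he]
  refine ⟨(hK.injective _).comp hb.1, fun x => ((hK.exact _) x).trans ⟨?_, ?_⟩⟩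
  · rintro ⟨y, rfl⟩
    obtain ⟨z, rfl⟩ := hb.2 y
    exact ⟨z, rfl⟩
  · rintro ⟨z, rfl⟩
    exact ⟨_, rfl⟩

end Cofree

/-! ### Cotensor products of cofree comodules, quasi-finiteness and injectors -/

section Functors

variable {k : Type v} [CommRing k] {A : Type u} [Ring A] [Algebra k A]
  {C : Type u} [AddCommGroup C] [Module A C] [Module Aᵐᵒᵖ C] [SMulCommClass A Aᵐᵒᵖ C] [Coring A C]
  {B : Type u} [Ring B] [Algebra k B]
  {D : Type u} [AddCommGroup D] [Module B D] [Module Bᵐᵒᵖ D] [SMulCommClass B Bᵐᵒᵖ D] [Coring B D]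
  [CentralBimodule k A A C]

section CotensorCofree

variable (X : Bicomod k A C B D)

theorem tensorLam_cotensorω (Z : Type u) [AddCommGroup Z] [Module Aᵐᵒᵖ Z] :
    tensorLam Z X ≫ cotensorω (tensorComod Z (Bicomod.regular k A C).toModComod) X = 0 := by
  ext t
  change (cotensorω (tensorComod Z (Bicomod.regular k A C).toModComod) X).lin
    (tensorLamLin Z X t) = 0
  rw [cotensorω_apply_eq_zero]
  exact map_comulLin Z X t

variable [LeftFlat B D]

/-- The isomorphism `Z ⊗_A X → (Z ⊗_A C) □_C X`. -/
noncomputable def tensorToCotensor (Z : Type u) [AddCommGroup Z] [Module Aᵐᵒᵖ Z] :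
    tensorComod Z X.toModComod ⟶
      (cotensor X).obj (tensorComod Z (Bicomod.regular k A C).toModComod) :=
  kerLift (tensorLam Z X) (tensorLam_cotensorω X Z)

/-- The sequence `Z ⊗ X → Z ⊗ C ⊗ X → Z ⊗ C ⊗ C ⊗ X` is contracted by the counit, so it is exact
without any condition on `Z`. -/
theorem tensorToCotensor_isIso (Z : Type u) [AddCommGroup Z] [Module Aᵐᵒᵖ Z] :
    IsIso (tensorToCotensor X Z) := by
  have he : Function.Exact (tensorLam Z X).lin
      (cotensorω (tensorComod Z (Bicomod.regular k A C).toModComod) X).lin := by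
    intro t
    constructor
    · intro ht
      have h : BT.map (comulLin C Z) LinearMap.id t = tensorLamLin (BT A Z C) X t :=
        (cotensorω_apply_eq_zero
          (Y := tensorComod Z (Bicomod.regular k A C).toModComod) (X := X)).1 ht
      exact exists_tensorLamLin X h
    · rintro ⟨s, rfl⟩
      exact congrArg (fun e => RComod.Hom.lin e s) (tensorLam_cotensorω X Z)
  exact RComod.isIso_of_bijective _ (kerLift_bijective (tensorLam Z X) (tensorLam_cotensorω X Z)
    (tensorLamLin_injective X Z) he)

/-- `(- ⊗_A C) □_C X ≅ - ⊗_A X`. -/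
noncomputable def tensorCotensorIso :
    tensorFunctor (Bicomod.regular k A C).toModComod ⋙ cotensor X ≅
      tensorFunctor X.toModComod :=
  Iso.symm (NatIso.ofComponents (F := tensorFunctor X.toModComod)
    (G := tensorFunctor (Bicomod.regular k A C).toModComod ⋙ cotensor X)
    (fun Z => @asIso _ _ _ _ (tensorToCotensor X Z) (tensorToCotensor_isIso X Z)) (fun {Z Z'} f => by
      apply ker_hom_ext
      exact tensorLam_naturality Z X f.hom))

/-- An adjunction `L ⊣ - □_C X` induces an adjunction `M^D → M_A ⊣ - ⊗_A X`. -/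
noncomputable def tensorAdj {L : RComod B D ⥤ RComod A C} (adj : L ⊣ cotensor X) :
    L ⋙ forgetComod A C ⊣ tensorFunctor X.toModComod :=
  (adj.comp (forgetAdj A C k)).ofNatIsoRight (tensorCotensorIso X)

theorem quasiFinite_of_adjunction {L : RComod B D ⥤ RComod A C} (adj : L ⊣ cotensor X) :
    QuasiFinite X :=
  (tensorAdj X adj).isRightAdjoint

/-- The left adjoint of `- ⊗_A X` is `L` followed by the forgetful functor; both preserve
monomorphisms, and the right adjoint of such a functor preserves injectives. -/
theorem injector_of_adjunction [LeftFlat A C] {L : RComod B D ⥤ RComod A C}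
    (adj : L ⊣ cotensor X) [L.PreservesMonomorphisms] : Injector X :=
  Functor.preservesInjectiveObjects_of_adjunction_of_preservesMonomorphisms (tensorAdj X adj)

end CotensorCofree

/-! ### The Eilenberg–Watts theorem for comodules -/

section Watts

variable [CentralBimodule k B B D] (F : RComod A C ⥤ RComod B D) [F.Additive] [F.Linear k]

section

variable (hF : F.IsLeftAdjoint) {R : Type u} [Ring R] [Algebra k R]
  {E : Type u} [AddCommGroup E] [Module R E] [Module Rᵐᵒᵖ E] [SMulCommClass R Rᵐᵒᵖ E]
  [Coring R E] (M : Bicomod k R E A C)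

/-- The morphism `Y ⊗_R F(M) → Y ⊗_R E ⊗_R F(M)` given by the left coaction of `F(M)`. -/
noncomputable def tensorInducedLam (Y : Type u) [AddCommGroup Y] [Module Rᵐᵒᵖ Y] :
    tensorComod Y (inducedModComod F M.toModComod) ⟶
      tensorComod (BT R Y E) (inducedModComod F M.toModComod) :=
  tensorLam Y (induced F hF M)

/-- The coaction of `F(M)` satisfies `Υ ∘ λ = F(λ_M)` by construction; this is that relation
tensored with `Y`, checked on each `y ⊗ -`. -/
theorem tensorInducedLam_upsilon (Y : Type u) [AddCommGroup Y] [Module Rᵐᵒᵖ Y] :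
    tensorInducedLam F hF M Y ≫ upsilon F (BT R Y E) M.toModComod =
      upsilon F Y M.toModComod ≫ F.map (tensorLam Y M) := by
  apply tensor_hom_ext
  intro y
  have e1 : tmulHom (inducedModComod F M.toModComod) y ≫ tensorInducedLam F hF M Y =
    inducedLam F hF M ≫ tensorComodMap _ (BT.tmulRight y) := rfl
  have e2 : tmulHom M.toModComod y ≫ tensorLam Y M =
    lamHom M ≫ tensorComodMap _ (BT.tmulRight y) := rfl
  rw [← Category.assoc, ← Category.assoc, e1, tmulHom_upsilon, ← F.map_comp, e2, F.map_comp,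
    ← inducedLam_upsilon F hF, Category.assoc, Category.assoc, upsilon_naturality]

/-- The morphism `Y ⊗_R F(M) → Y ⊗_R E ⊗_R F(M)` whose kernel is `Y □_E F(M)`. -/
noncomputable def inducedω (Y : RComod R E) :
    tensorComod Y.carrier (inducedModComod F M.toModComod) ⟶
      tensorComod (BT R Y.carrier E) (inducedModComod F M.toModComod) :=
  cotensorω Y (induced F hF M)

theorem inducedω_eq (Y : RComod R E) : inducedω F hF M Y =
    tensorComodMap _ Y.ρ - tensorInducedLam F hF M Y.carrier := rfl

/-- `Υ` identifies the map that defines `Y □_E F(M)` with the image under `F` of the one that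
defines `Y □_E M`. -/
theorem inducedω_upsilon (Y : RComod R E) :
    inducedω F hF M Y ≫ upsilon F (BT R Y.carrier E) M.toModComod =
      upsilon F Y.carrier M.toModComod ≫ F.map (cotensorω Y M) := by
  rw [inducedω_eq, cotensorω, Preadditive.sub_comp, F.map_sub, Preadditive.comp_sub,
    upsilon_naturality, tensorInducedLam_upsilon]

end

/-- The morphism `F(Y) → F(Y ⊗_A C) ≅ Y ⊗_A F(C)`. -/
noncomputable def mapCoact (hF : F.IsLeftAdjoint) (Y : RComod A C) :
    F.obj Y ⟶ tensorComod Y.carrier (inducedModComod F (Bicomod.regular k A C).toModComod) :=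
  haveI := upsilon_isIso (Y := Y.carrier) F hF (Bicomod.regular k A C).toModComod
  F.map (coactHom k Y) ≫ inv (upsilon F Y.carrier (Bicomod.regular k A C).toModComod)

theorem mapCoact_upsilon (hF : F.IsLeftAdjoint) (Y : RComod A C) :
    mapCoact (k := k) F hF Y ≫ upsilon F Y.carrier (Bicomod.regular k A C).toModComod =
      F.map (coactHom k Y) := by
  have := upsilon_isIso (Y := Y.carrier) F hF (Bicomod.regular k A C).toModComod
  rw [mapCoact, Category.assoc, IsIso.inv_hom_id, Category.comp_id]

theorem mapCoact_inducedω (hF : F.IsLeftAdjoint) (Y : RComod A C) :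
    mapCoact F hF Y ≫ inducedω F hF (Bicomod.regular k A C) Y = 0 := by
  apply upsilon_cancel F hF
  rw [Category.assoc, inducedω_upsilon, ← Category.assoc, mapCoact_upsilon, ← F.map_comp,
    coactHom_cotensorω, F.map_zero, Limits.zero_comp]

theorem mapCoact_naturality (hF : F.IsLeftAdjoint) {Y Y' : RComod A C} (g : Y ⟶ Y') :
    F.map g ≫ mapCoact (k := k) F hF Y' =
      mapCoact F hF Y ≫ tensorComodMap _ g.lin := by
  apply upsilon_cancel F hF
  rw [Category.assoc, mapCoact_upsilon, Category.assoc, upsilon_naturality, ← Category.assoc,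
    mapCoact_upsilon, ← F.map_comp, ← F.map_comp, coactHom_naturality]

end Watts

section

variable [LeftFlat A C]

variable [CentralBimodule k B B D] {F : RComod A C ⥤ RComod B D} [F.Additive] [F.Linear k]

/-- The morphism `F(Y) → Y □_C F(C)`. -/
noncomputable def mapCoactLift [LeftFlat B D] (hF : F.IsLeftAdjoint) (Y : RComod A C) :
    F.obj Y ⟶ (cotensor (induced F hF (Bicomod.regular k A C))).obj Y :=
  kerLift (mapCoact F hF Y) (mapCoact_inducedω F hF Y)

/-- Applying `F` to `0 → Y → Y ⊗ C → Y ⊗ C ⊗ C` keeps it exact, and `Υ` turns the result into the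
sequence that defines `Y □_C F(C)`. -/
theorem mapCoactLift_isIso [LeftFlat B D] (hF : F.IsLeftAdjoint) (hK : PreservesComodKernels F)
    (Y : RComod A C) : IsIso (mapCoactLift (k := k) hF Y) := by
  obtain ⟨hi, he⟩ := hK.map_coact (k := k) Y
  have hu : ∀ y, (upsilon F Y.carrier (Bicomod.regular k A C).toModComod).lin
      ((mapCoact F hF Y).lin y) = (F.map (coactHom k Y)).lin y :=
    fun y => congrArg (fun e => RComod.Hom.lin e y) (mapCoact_upsilon F hF Y)
  have := upsilon_isIso (Y := Y.carrier) F hF (Bicomod.regular k A C).toModComod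
  have hb := RComod.bijective_of_isIso
    (upsilon F Y.carrier (Bicomod.regular k A C).toModComod)
  refine RComod.isIso_of_bijective _ (kerLift_bijective _ (mapCoact_inducedω F hF Y) ?_ ?_)
  · intro x y h
    apply hi
    rw [← hu, ← hu, h]
  · intro t
    constructor
    · intro ht
      have h := congrArg (fun e => RComod.Hom.lin e t) (inducedω_upsilon F hF (Bicomod.regular k A C) Y)
      have h0 : (F.map (cotensorω Y (Bicomod.regular k A C))).lin
          ((upsilon F Y.carrier (Bicomod.regular k A C).toModComod).lin t) = 0 := by
        refine h.symm.trans ?_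
        refine (congrArg (upsilon F _ (Bicomod.regular k A C).toModComod).lin ht).trans ?_
        exact map_zero _
      obtain ⟨y, hy⟩ := (he _).1 h0
      exact ⟨y, hb.1 ((hu y).trans hy)⟩
    · rintro ⟨y, rfl⟩
      exact congrArg (fun e => RComod.Hom.lin e y) (mapCoact_inducedω (k := k) F hF Y)

/-- A `k`-linear left adjoint functor that preserves kernels is the cotensor product with its
value at the coring. -/
noncomputable def isoCotensorInduced [LeftFlat B D] (hF : F.IsLeftAdjoint)
    (hK : PreservesComodKernels F) : F ≅ cotensor (induced F hF (Bicomod.regular k A C)) :=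
  NatIso.ofComponents
    (fun Y =>
      haveI := mapCoactLift_isIso (k := k) hF hK Y
      asIso (mapCoactLift (k := k) hF Y))
    (fun {Y Y'} g => by
      apply ker_hom_ext
      exact mapCoact_naturality F hF g)

end

end Functors

variable {k : Type v} [CommRing k] {A : Type u} [Ring A] [Algebra k A]
  {C : Type u} [AddCommGroup C] [Module A C] [Module Aᵐᵒᵖ C] [SMulCommClass A Aᵐᵒᵖ C] [Coring A C]
  {B : Type u} [Ring B] [Algebra k B]
  {D : Type u} [AddCommGroup D] [Module B D] [Module Bᵐᵒᵖ D] [SMulCommClass B Bᵐᵒᵖ D] [Coring B D]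

/-! ### Exactness of the co-hom functor -/

section Cohom

variable (X : Bicomod k A C B D) (hX : QuasiFinite X)

/-- The co-hom functor of an injector preserves injective morphisms. -/
theorem cohom_map_injective (hI : Injector X) {M N : RComod B D} (f : M ⟶ N)
    (hf : Function.Injective f.lin) : Function.Injective ((cohom X hX).map f).lin := by
  have : (tensorFunctor X.toModComod).PreservesInjectiveObjects := hI
  -- Embed `h(M)` in an injective module `I`; the transpose `M → I ⊗_A X` extends along `f` because
  -- `I ⊗_A X` is injective, and so `h(M) → I` factors through `h(f)`.
  have := Functor.preservesMonomorphisms_of_adjunction_of_preservesInjectiveObjects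
    (cohomModAdj X hX)
  have := mono_of_injective f hf
  exact (ModuleCat.mono_iff_injective ((cohomMod X hX).map f)).1 inferInstance

variable [LeftFlat B D]

/-- The co-hom functor is right exact. -/
theorem cohom_exact_coimπ {M N : RComod B D} (f : M ⟶ N) :
    Function.Exact ((cohom X hX).map (kerι f)).lin ((cohom X hX).map (coimπ f)).lin := by
  intro y
  constructor
  · intro hy
    -- It suffices that the projection `h(M) → h(M)/S` factors through `h(coim f)`. Its transpose `g
    -- : M → (h(M)/S) ⊗_A X` vanishes on `ker f`, so it descends to the coimage, and transposing
    -- back gives the factorization.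
    let S := LinearMap.range ((cohom X hX).map (kerι f)).lin
    have h0 : S.mkQ ∘ₗ ((cohom X hX).map (kerι f)).lin = 0 := by
      ext z
      exact (Submodule.Quotient.mk_eq_zero S).2 ⟨z, rfl⟩
    let g : M ⟶ tensorComod _ X.toModComod := cohomUnit X hX M ≫ tensorComodMap _ S.mkQ
    have hg : kerι f ≫ g = 0 := by
      ext m
      refine (congrArg (BT.map S.mkQ LinearMap.id)
        (cohomUnit_naturality X hX (kerι f) m).symm).trans ?_
      refine (BT.map_comp_left _ _ _).symm.trans ?_
      refine (congrArg (fun e => BT.map e LinearMap.id ((cohomUnit X hX (kerComod f)).lin m))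
        h0).trans (BT.zero_map _)
    have hq : cohomDesc X hX (coimDesc g hg) ∘ₗ ((cohom X hX).map (coimπ f)).lin = S.mkQ := by
      apply cohom_ext
      intro m
      refine (BT.map_comp_left _ _ _).trans ?_
      refine (congrArg (BT.map _ LinearMap.id) (cohomUnit_naturality X hX (coimπ f) m)).trans ?_
      exact cohomDesc_unit X hX _ _
    apply (Submodule.Quotient.mk_eq_zero S).1
    refine (LinearMap.congr_fun hq y).symm.trans ?_
    exact (congrArg (cohomDesc X hX (coimDesc g hg)) hy).trans (map_zero _)
  · rintro ⟨z, rfl⟩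
    have h : kerι f ≫ coimπ f = 0 := by
      ext m
      exact (Submodule.Quotient.mk_eq_zero _).2 m.2
    have h' : (cohom X hX).map (kerι f) ≫ (cohom X hX).map (coimπ f) = 0 := by
      rw [← Functor.map_comp, h, Functor.map_zero]
    exact congrArg (fun e => RComod.Hom.lin e z) h'

/-- The co-hom functor of an injector preserves kernels. -/
theorem cohom_preservesComodKernels (hI : Injector X) : PreservesComodKernels (cohom X hX) where
  injective f := cohom_map_injective X hX hI _ (kerι_injective f)
  exact f := by
    -- Factor `f` through its coimage: `h` keeps the inclusion `coimι f` injective, so `h(f)` and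
    -- `h(coimπ f)` have the same kernel, which right exactness identifies.
    have h : ((cohom X hX).map f).lin =
        ((cohom X hX).map (coimι f)).lin ∘ₗ ((cohom X hX).map (coimπ f)).lin := by
      rw [← RComod.comp_lin, ← Functor.map_comp]
      rfl
    intro y
    rw [h, ← cohom_exact_coimπ X hX f y, LinearMap.comp_apply]
    exact map_eq_zero_iff _ (cohom_map_injective X hX hI _ (coimι_injective f))

end Cohom

/-! ### Frobenius pairs and the equivalence of the five conditions -/

theorem IsFrobeniusPair.congr {𝒞 𝒟 : Type*} [Category 𝒞] [Category 𝒟] {F F' : 𝒞 ⥤ 𝒟}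
    {G G' : 𝒟 ⥤ 𝒞} (h : IsFrobeniusPair F G) (e : F ≅ F') (e' : G ≅ G') :
    IsFrobeniusPair F' G' := by
  obtain ⟨⟨a⟩, ⟨b⟩⟩ := h
  exact ⟨⟨(a.ofNatIsoLeft e).ofNatIsoRight e'⟩, ⟨(b.ofNatIsoLeft e').ofNatIsoRight e⟩⟩

variable [CentralBimodule k A A C] [CentralBimodule k B B D] [LeftFlat A C] [LeftFlat B D]

/-- If `- □_D Λ` is left adjoint to `- □_C X`, then `h_D(X, D) ≅ Λ` as bicomodules. -/
theorem cohomBicomod_iso {X : Bicomod k A C B D} {Λ : Bicomod k B D A C}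
    (adj : cotensor Λ ⊣ cotensor X) (hX : QuasiFinite X) : Nonempty (cohomBicomod X hX ≅ Λ) := by
  -- Both `h_D(X, -)` and `- □_D Λ` are left adjoint to `- □_C X`, so their values at `D` agree, and
  -- `D □_D Λ ≅ Λ`.
  obtain ⟨e⟩ := induced_iso (cohom_isLeftAdjoint X hX) adj.isLeftAdjoint
    ((cohomAdj X hX).leftAdjointUniq adj) (Bicomod.regular k B D)
  obtain ⟨e'⟩ := induced_cotensor_iso Λ adj.isLeftAdjoint
  exact ⟨e ≪≫ e'⟩

/-- A kernel-preserving co-hom functor `h_D(X, -)` with `h_D(X, D) ≅ Λ` is `- □_D Λ`. -/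
theorem cohom_iso_cotensor {X : Bicomod k A C B D} {Λ : Bicomod k B D A C} (hX : QuasiFinite X)
    (hK : PreservesComodKernels (cohom X hX)) (e : cohomBicomod X hX ≅ Λ) :
    Nonempty (cohom X hX ≅ cotensor Λ) :=
  ⟨isoCotensorInduced (k := k) (cohom_isLeftAdjoint X hX) hK ≪≫ cotensorIso e⟩

end CoringTheory

theorem mainTheorem3
    {k : Type v} [CommRing k]
    {A : Type u} [Ring A] [Algebra k A]
    {C : Type u} [AddCommGroup C] [Module A C] [Module Aᵐᵒᵖ C] [SMulCommClass A Aᵐᵒᵖ C]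
    [CoringTheory.Coring A C] [CoringTheory.CentralBimodule k A A C]
    {B : Type u} [Ring B] [Algebra k B]
    {D : Type u} [AddCommGroup D] [Module B D] [Module Bᵐᵒᵖ D] [SMulCommClass B Bᵐᵒᵖ D]
    [CoringTheory.Coring B D] [CoringTheory.CentralBimodule k B B D]
    [CoringTheory.LeftFlat A C] [CoringTheory.LeftFlat B D]
    (X : CoringTheory.Bicomod k A C B D) (Λ : CoringTheory.Bicomod k B D A C) :
    List.TFAE
      [ CoringTheory.IsFrobeniusPair (CoringTheory.cotensor X) (CoringTheory.cotensor Λ),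
        CoringTheory.IsFrobeniusFunctor (CoringTheory.cotensor X) ∧
          ∃ hX : CoringTheory.QuasiFinite X, Nonempty (CoringTheory.cohomBicomod X hX ≅ Λ),
        ∃ (F : CoringTheory.RComod A C ⥤ CoringTheory.RComod B D)
          (G : CoringTheory.RComod B D ⥤ CoringTheory.RComod A C)
          (_ : F.Additive) (_ : F.Linear k) (_ : G.Additive) (_ : G.Linear k)
          (h : CoringTheory.IsFrobeniusPair F G),
          Nonempty (CoringTheory.induced F h.isLeftAdjoint_left
            (CoringTheory.Bicomod.regular k A C) ≅ X) ∧
          Nonempty (CoringTheory.induced G h.isLeftAdjoint_right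
            (CoringTheory.Bicomod.regular k B D) ≅ Λ),
        ∃ (hΛ : CoringTheory.QuasiFinite Λ) (hX : CoringTheory.QuasiFinite X),
          CoringTheory.Injector Λ ∧ CoringTheory.Injector X ∧
          Nonempty (X ≅ CoringTheory.cohomBicomod Λ hΛ) ∧
          Nonempty (Λ ≅ CoringTheory.cohomBicomod X hX),
        ∃ (hΛ : CoringTheory.QuasiFinite Λ) (hX : CoringTheory.QuasiFinite X),
          Nonempty (CoringTheory.cotensor X ≅ CoringTheory.cohom Λ hΛ) ∧
          Nonempty (CoringTheory.cotensor Λ ≅ CoringTheory.cohom X hX) ] := by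
  open CoringTheory in
  tfae_have 1 → 2 := fun h => by
    obtain ⟨a⟩ := h.right_left
    have hX := quasiFinite_of_adjunction X a
    exact ⟨⟨_, h⟩, hX, cohomBicomod_iso a hX⟩
  tfae_have 2 → 1 := by
    rintro ⟨⟨G, ⟨⟨a⟩, ⟨b⟩⟩⟩, hX, ⟨e⟩⟩
    -- The partner `G` is a left adjoint of `- □_C X`, hence is `h_D(X, -)`. Being also a right
    -- adjoint, it preserves kernels, so its value `Λ` at `D` determines it.
    have e' := b.leftAdjointUniq (cohomAdj X hX)
    have hR : (cohom X hX).IsRightAdjoint := (a.ofNatIsoRight e').isRightAdjoint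
    obtain ⟨e''⟩ := cohom_iso_cotensor hX (.of_isRightAdjoint _ hR) e
    exact (IsFrobeniusPair.mk ⟨a⟩ ⟨b⟩).congr (Iso.refl _) (e' ≪≫ e'')
  tfae_have 1 → 3 := fun h =>
    ⟨_, _, inferInstance, inferInstance, inferInstance, inferInstance, h,
      induced_cotensor_iso X _, induced_cotensor_iso Λ _⟩
  tfae_have 3 → 1 := by
    rintro ⟨F, G, _, _, _, _, h, ⟨e⟩, ⟨e'⟩⟩
    obtain ⟨a⟩ := h.left_right
    obtain ⟨b⟩ := h.right_left
    -- Each functor of the pair is a left adjoint, and a right adjoint of the other, so the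
    -- Eilenberg–Watts theorem applies to both.
    exact h.congr
      (isoCotensorInduced (k := k) _ (.of_isRightAdjoint F b.isRightAdjoint) ≪≫ cotensorIso e)
      (isoCotensorInduced (k := k) _ (.of_isRightAdjoint G a.isRightAdjoint) ≪≫ cotensorIso e')
  tfae_have 1 → 4 := by
    rintro ⟨⟨a⟩, ⟨b⟩⟩
    have hX := quasiFinite_of_adjunction X b
    have hΛ := quasiFinite_of_adjunction Λ a
    -- The injector property of `Λ` needs the left adjoint of `- □_D Λ`, namely `- □_C X`, to
    -- preserve monomorphisms; it does, as it is also a right adjoint. The roles are exchanged for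
    -- `X`.
    have : (cotensor X).PreservesMonomorphisms := Functor.preservesMonomorphisms_of_adjunction b
    have : (cotensor Λ).PreservesMonomorphisms := Functor.preservesMonomorphisms_of_adjunction a
    obtain ⟨e⟩ := cohomBicomod_iso a hΛ
    obtain ⟨e'⟩ := cohomBicomod_iso b hX
    exact ⟨hΛ, hX, injector_of_adjunction Λ a, injector_of_adjunction X b, ⟨e.symm⟩, ⟨e'.symm⟩⟩
  tfae_have 4 → 5 := by
    rintro ⟨hΛ, hX, iΛ, iX, ⟨e⟩, ⟨e'⟩⟩
    obtain ⟨f⟩ := cohom_iso_cotensor hΛ (cohom_preservesComodKernels Λ hΛ iΛ) e.symm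
    obtain ⟨f'⟩ := cohom_iso_cotensor hX (cohom_preservesComodKernels X hX iX) e'.symm
    exact ⟨hΛ, hX, ⟨f.symm⟩, ⟨f'.symm⟩⟩
  tfae_have 5 → 1 := by
    rintro ⟨hΛ, hX, ⟨e⟩, ⟨e'⟩⟩
    -- The two required adjunctions are the co-hom adjunctions of `Λ` and `X`, with the co-hom
    -- functors replaced by the isomorphic cotensor functors.
    exact ⟨⟨(cohomAdj Λ hΛ).ofNatIsoLeft e.symm⟩, ⟨(cohomAdj X hX).ofNatIsoLeft e'.symm⟩⟩
  tfae_finish
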